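/- Let $Q$ be a smooth $n$-dimensional manifold (Hausdorff, second countable, without boundary) with a smooth Riemannian metric $g_A$, let $M$ be a smooth one-dimensional manifold (Hausdorff, second countable, without boundary; the task space), and let $H:Q\to M$ be a smooth submersion. The level sets of $H$ induce a foliation of $Q$ whose tangent space at $q$ is $\ker dH_q$ (the task-induced foliation). For a local coordinate $x$ of $M$ put $h=x\circ H$, and let $\nabla_A h$ be its gradient with respect to $g_A$. Then: 1. For every local coordinate $x$ of $M$, the gradient $\nabla_A h$ vanishes nowhere on the domain of $h$, and the distribution $\Delta_h$ spanned by the gradients of the local task coordinates equals $\operatorname{span}\{\nabla_A h\}$ there; in particular it is one-dimensional and independent of the choice of $x$. 2. $\Delta_h$ is involutive: if $V,W$ are smooth vector fields on an open set $U\subseteq Q$ with values in $\Delta_h$, then $[V,W]$ has values in $\Delta_h$ on $U$. 3. The task-induced foliation admits orthogonal foliations with respect to $g_A$: there is a foliation $\mathcal F$ of all of $Q$ by one-dimensional leaves (connected, injectively immersed submanifolds that partition $Q$, with a flat chart around every point) such that the tangent space of the leaf of $\mathcal F$ at each $q\in Q$ is the $g_A$-orthogonal complement of $\ker dH_q$.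 Moreover, each point of $Q$ has an open neighbourhood $U$ and a smooth map $\xi=(\xi_1,\dots,\xi_{n-1}):U\to\mathbb R^{n-1}$ such that, at every point of $U$, $dH(\nabla_A\xi_j)=0$ for all $j$ and the linear map $(dH,d\xi)$ is bijective, and such that each level set of $\xi$ in $U$ is contained in a single leaf of $\mathcal F$. (So the level sets of the single functions $\xi_j$ are $n-1$ foliations of $U$ by hypersurfaces, each orthogonal to the task-induced foliation in the sense that $dh(\nabla_A\xi_j)=0$.) -/

import Mathlib

open scoped Manifold ContDiff
open Set

universe u v

namespace RedundantRobot

section Metric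

variable {n m : ℕ}
  {Q : Type u} [TopologicalSpace Q] [ChartedSpace (EuclideanSpace ℝ (Fin n)) Q]
  [IsManifold (𝓡 n) ∞ Q]
  {M : Type v} [TopologicalSpace M] [ChartedSpace (EuclideanSpace ℝ (Fin m)) M]
  [IsManifold (𝓡 m) ∞ M]

variable (n Q) in
/-- Smooth Riemannian metrics on an `n`-dimensional smooth manifold `Q` without boundary. -/
abbrev Metric :=
  Bundle.ContMDiffRiemannianMetric (𝓡 n) ∞ (EuclideanSpace ℝ (Fin n))
    (fun q : Q => TangentSpace (𝓡 n) q)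

/-- Lowering an index: `v ↦ g_q(v, ·)`. -/
noncomputable def lowerIndex (g : Metric n Q) (q : Q) :
    TangentSpace (𝓡 n) q →ₗ[ℝ] Module.Dual ℝ (TangentSpace (𝓡 n) q) where
  toFun v := (g.inner q v).toLinearMap
  map_add' v w := by ext x; simp
  map_smul' c v := by ext x; simp

theorem lowerIndex_apply (g : Metric n Q) (q : Q) (v w : TangentSpace (𝓡 n) q) :
    lowerIndex g q v w = g.inner q v w := rfl

theorem lowerIndex_bijective (g : Metric n Q) (q : Q) :
    Function.Bijective (lowerIndex g q) := by
  have : FiniteDimensional ℝ (TangentSpace (𝓡 n) q) :=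
    inferInstanceAs (FiniteDimensional ℝ (EuclideanSpace ℝ (Fin n)))
  have hinj : Function.Injective (lowerIndex g q) := by
    rw [injective_iff_map_eq_zero]
    intro v hv
    by_contra hne
    have h := g.pos q v hne
    rw [← lowerIndex_apply, hv] at h
    exact lt_irrefl _ h
  exact ⟨hinj, (LinearMap.injective_iff_surjective_of_finrank_eq_finrank
    Subspace.dual_finrank_eq.symm).1 hinj⟩

/-- The gradient of `f : Q → ℝ` with respect to `g`: the vector `∇_g f(q)` obtained from the
covector `df(q)` by raising an index. -/
noncomputable def gradient (g : Metric n Q) (f : Q → ℝ) (q : Q) : TangentSpace (𝓡 n) q :=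
  (LinearEquiv.ofBijective (lowerIndex g q) (lowerIndex_bijective g q)).symm
    (mfderiv (𝓡 n) 𝓘(ℝ, ℝ) f q).toLinearMap

/-- The defining property of the gradient, `g(∇f, w) = df(w)`. -/
theorem inner_gradient (g : Metric n Q) (f : Q → ℝ) (q : Q) (w : TangentSpace (𝓡 n) q) :
    g.inner q (gradient g f q) w = mfderiv (𝓡 n) 𝓘(ℝ, ℝ) f q w := by
  have h := (LinearEquiv.ofBijective (lowerIndex g q)
    (lowerIndex_bijective g q)).apply_symm_apply (mfderiv (𝓡 n) 𝓘(ℝ, ℝ) f q).toLinearMap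
  exact congrArg (fun l : Module.Dual ℝ (TangentSpace (𝓡 n) q) => l w) h

/-- The orthogonal complement of a subspace of the tangent space with respect to `g`. -/
def orthogonalComplement (g : Metric n Q) (q : Q) (D : Submodule ℝ (TangentSpace (𝓡 n) q)) :
    Submodule ℝ (TangentSpace (𝓡 n) q) where
  carrier := {v | ∀ w ∈ D, g.inner q v w = 0}
  add_mem' := by
    intro a b ha hb w hw
    simp [ha w hw, hb w hw]
  zero_mem' := by
    intro w _
    simp
  smul_mem' := by
    intro c x hx w hw
    simp [hx w hw]

/-- The `i`-th task coordinate `h_i = x_i ∘ H` in the chart `x` of the task space. -/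
def taskCoord (H : Q → M) (x : OpenPartialHomeomorph M (EuclideanSpace ℝ (Fin m)))
    (i : Fin m) : Q → ℝ :=
  fun q => x (H q) i

/-- The span at `q` of the gradients of the task coordinates belonging to the chart `x`. -/
noncomputable def gradientSpan (g : Metric n Q) (H : Q → M)
    (x : OpenPartialHomeomorph M (EuclideanSpace ℝ (Fin m))) (q : Q) :
    Submodule ℝ (TangentSpace (𝓡 n) q) :=
  Submodule.span ℝ (range fun i : Fin m => gradient g (taskCoord H x i) q)

/-- The distribution `Δ_h` locally spanned by the gradients of the task coordinates; at `q` it is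
computed in the preferred chart of the task space at `H q`. -/
noncomputable def gradientDistribution (g : Metric n Q) (H : Q → M) (q : Q) :
    Submodule ℝ (TangentSpace (𝓡 n) q) :=
  gradientSpan g H (chartAt (EuclideanSpace ℝ (Fin m)) (H q)) q

/-- The tangent space at `q` of the leaf of the task-induced foliation (that is, of the level set
of `H`, the self-motion manifold) through `q`: the kernel of the push-forward. -/
noncomputable def taskTangent (H : Q → M) (q : Q) : Submodule ℝ (TangentSpace (𝓡 n) q) :=
  (mfderiv (𝓡 n) (𝓡 m) H q).ker

/-- The vector field `V` is smooth on `U`. -/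
def SmoothVectorFieldOn (V : ∀ q : Q, TangentSpace (𝓡 n) q) (U : Set Q) : Prop :=
  ContMDiffOn (𝓡 n) (𝓡 n).tangent ∞ (fun q => (⟨q, V q⟩ : TangentBundle (𝓡 n) Q)) U

/-- A distribution is involutive if the Lie bracket of any two of its smooth local sections is
again a local section. -/
def IsInvolutive (D : ∀ q : Q, Submodule ℝ (TangentSpace (𝓡 n) q)) : Prop :=
  ∀ (U : Set Q) (V W : ∀ q : Q, TangentSpace (𝓡 n) q), IsOpen U →
    SmoothVectorFieldOn V U → SmoothVectorFieldOn W U →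
    (∀ q ∈ U, V q ∈ D q) → (∀ q ∈ U, W q ∈ D q) →
    ∀ q ∈ U, VectorField.mlieBracket (𝓡 n) V W q ∈ D q

end Metric

section Foliation

/-- An immersed `k`-dimensional submanifold of `Q`: a `k`-manifold together with an injective
smooth immersion into `Q`. -/
structure ImmersedSubmanifold (n k : ℕ) (Q : Type u) [TopologicalSpace Q]
    [ChartedSpace (EuclideanSpace ℝ (Fin n)) Q] where
  carrier : Type u
  [topology : TopologicalSpace carrier]
  [t2 : T2Space carrier]
  [secondCountable : SecondCountableTopology carrier]
  [charted : ChartedSpace (EuclideanSpace ℝ (Fin k)) carrier]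
  [manifold : IsManifold (𝓡 k) ∞ carrier]
  incl : carrier → Q
  smooth_incl : ContMDiff (𝓡 k) (𝓡 n) ∞ incl
  injective_incl : Function.Injective incl
  injective_mfderiv : ∀ y, Function.Injective (mfderiv (𝓡 k) (𝓡 n) incl y)

attribute [instance] ImmersedSubmanifold.topology ImmersedSubmanifold.t2
  ImmersedSubmanifold.secondCountable ImmersedSubmanifold.charted ImmersedSubmanifold.manifold

variable {n k : ℕ} {Q : Type u} [TopologicalSpace Q] [ChartedSpace (EuclideanSpace ℝ (Fin n)) Q]

/-- The underlying set of points in `Q`. -/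
def ImmersedSubmanifold.points (L : ImmersedSubmanifold n k Q) : Set Q := range L.incl

/-- The tangent space of the submanifold, as a subspace of the tangent space of `Q`. -/
noncomputable def ImmersedSubmanifold.tangent (L : ImmersedSubmanifold n k Q) (y : L.carrier) :
    Submodule ℝ (TangentSpace (𝓡 n) (L.incl y)) :=
  (mfderiv (𝓡 k) (𝓡 n) L.incl y).range

/-- The last `n - k` coordinates, which are constant on the `k`-dimensional slices. -/
def transverse (n k : ℕ) (y : EuclideanSpace ℝ (Fin n)) : {i : Fin n // k ≤ (i : ℕ)} → ℝ :=
  fun i => y i.1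

/-- A `k`-dimensional foliation of the `n`-manifold `Q`: a collection of connected immersed
`k`-dimensional submanifolds (the leaves) that partition `Q`, such that each point of `Q` lies in
the domain of a flat chart: the image of the chart is an open box and each leaf meets the
domain in a countable (possibly empty) union of `k`-dimensional slices. -/
structure Foliation (n k : ℕ) (Q : Type u) [TopologicalSpace Q]
    [ChartedSpace (EuclideanSpace ℝ (Fin n)) Q] where
  index : Type u
  leaf : index → ImmersedSubmanifold n k Q
  connected : ∀ i, ConnectedSpace (leaf i).carrier
  partition : ∀ q, ∃! i, q ∈ (leaf i).points
  flat : ∀ q : Q, ∃ φ ∈ IsManifold.maximalAtlas (𝓡 n) ∞ Q, q ∈ φ.source ∧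
    (∃ a b : Fin n → ℝ, φ.target = {y | ∀ j, a j < y j ∧ y j < b j}) ∧
    ∀ i, ∃ C : Set ({j : Fin n // k ≤ (j : ℕ)} → ℝ), C.Countable ∧
      ∀ p ∈ φ.source, p ∈ (leaf i).points ↔ transverse n k (φ p) ∈ C

end Foliation

section Orthogonal

variable {n m : ℕ}
  {Q : Type u} [TopologicalSpace Q] [ChartedSpace (EuclideanSpace ℝ (Fin n)) Q]
  [IsManifold (𝓡 n) ∞ Q]
  {M : Type v} [TopologicalSpace M] [ChartedSpace (EuclideanSpace ℝ (Fin m)) M]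
  [IsManifold (𝓡 m) ∞ M]

/-- The leaves of the `m`-dimensional foliation `F` are everywhere the orthogonal complements,
with respect to `g`, of the leaves of the foliation by level sets of `H`. -/
def IsOrthogonalToTask (g : Metric n Q) (H : Q → M) (F : Foliation n m Q) : Prop :=
  ∀ (i : F.index) (y : (F.leaf i).carrier),
    (F.leaf i).tangent y = orthogonalComplement g _ (taskTangent (m := m) H ((F.leaf i).incl y))

/-- `ξ = (ξ_1, …, ξ_r)`, `r = n - m`, are orthogonal coordinates on the open set `U`: they are
smooth, their gradients are annihilated by the push-forward of `H` (so `dh_i(∇ξ_j) = 0` in task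
coordinates, i.e. `J_x A⁻¹ J_ξᵀ = 0`), and the stacked Jacobian of `(H, ξ)` is invertible. In
particular the level sets of each `ξ_j` form a foliation of `U` by hypersurfaces, each of which is
orthogonal to the task-induced foliation in the sense of the metric. -/
def IsOrthogonalCoordOn (g : Metric n Q) (H : Q → M) (U : Set Q)
    (ξ : Q → EuclideanSpace ℝ (Fin (n - m))) : Prop :=
  ContMDiffOn (𝓡 n) (𝓡 (n - m)) ∞ ξ U ∧
  ∀ p ∈ U,
    (∀ j, mfderiv (𝓡 n) (𝓡 m) H p (gradient g (fun q => ξ q j) p) = 0) ∧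
    Function.Bijective (fun v : TangentSpace (𝓡 n) p =>
      (mfderiv (𝓡 n) (𝓡 m) H p v, mfderiv (𝓡 n) (𝓡 (n - m)) ξ p v))

/-- The task-induced foliation of `H` admits orthogonal foliations with respect to `g`: there is a
foliation of all of `Q` whose leaves are orthogonal complements of the self-motion manifolds, and
near each point it is induced by orthogonal coordinates `ξ`, i.e. the joint level sets of `ξ` lie
in leaves of that foliation. -/
def AdmitsOrthogonalFoliations (g : Metric n Q) (H : Q → M) : Prop :=
  ∃ F : Foliation n m Q, IsOrthogonalToTask (m := m) g H F ∧
    ∀ q : Q, ∃ (U : Set Q) (ξ : Q → EuclideanSpace ℝ (Fin (n - m))),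
      IsOpen U ∧ q ∈ U ∧ IsOrthogonalCoordOn (m := m) g H U ξ ∧
      ∀ i, ∀ p ∈ U, ∀ p' ∈ U, ξ p = ξ p' → p ∈ (F.leaf i).points → p' ∈ (F.leaf i).points

end Orthogonal

end RedundantRobot

/-! Since `M` is one-dimensional, `dh` and `dH` have the same kernel for every task coordinate `h`,
and `dh(∇h) = g(∇h, ∇h) > 0` because `dH` is onto. Subtracting from a vector orthogonal to `ker dH`
a multiple of `∇h` leaves a vector that is both in `ker dH` and orthogonal to it, hence zero. So
`∇h` spans `(ker dH)^⊥`, a description free of charts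
(`gradientDistribution_eq_orthogonalComplement`), which gives the first claim.

A smooth line field is locally straightened by a flow box. The local flow is produced by solving
`u(t) = y + s ∫₀ᵗ X(u)` with the inverse function theorem in a Banach space of paths
(`exists_local_flow`). Inverting the flow on a transversal hyperplane gives first integrals `ξ` of
the gradient (`exists_first_integral`), and `(h, ξ)` is a coordinate system in which `Δ_h` is the
direction of the first axis (`exists_flat_chart`). The remaining claims are read off from these flat
charts.

In a flat chart, the sections of `Δ_h` are the fields with zero transverse part, a condition stable
under brackets. For the global leaves, `Q` is retopologized so that the plaques (slices of flat
charts) are open; transition maps preserve plaques locally, so this gives a one-dimensional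
manifold, and the leaves are its connected components. They are second countable because countably
many flat charts cover `Q` and each plaque meets only countably many plaques of each of them. The
transverse coordinates of a flat chart are the orthogonal coordinates: `dh(∇ξ_j) = g(∇h, ∇ξ_j) =
dξ_j(∇h) = 0`, and `ker dξ = (ker dH)^⊥` meets `ker dH` only in zero. -/

namespace RedundantRobot

open Topology Filter

/-! ### Inverse function theorem in Banach spaces -/

section InverseFunction

variable {E F : Type*} [NormedAddCommGroup E] [NormedSpace ℝ E] [CompleteSpace E]
  [NormedAddCommGroup F] [NormedSpace ℝ F]

/-- The smooth inverse function theorem, with a smooth inverse on the whole target. -/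
theorem exists_openPartialHomeomorph_of_contDiffOn [CompleteSpace F] {f : E → F} {Ω : Set E}
    {x : E} (hΩ : IsOpen Ω) (hf : ContDiffOn ℝ ∞ f Ω) (hx : x ∈ Ω)
    (hinv : (fderiv ℝ f x).IsInvertible) :
    ∃ e : OpenPartialHomeomorph E F, x ∈ e.source ∧ e.source ⊆ Ω ∧ (e : E → F) = f ∧
      (∀ z ∈ e.source, (fderiv ℝ f z).IsInvertible) ∧ ContDiffOn ℝ ∞ e.symm e.target := by
  have hat : ∀ z ∈ Ω, ContDiffAt ℝ ∞ f z := fun z hz => hf.contDiffAt (hΩ.mem_nhds hz)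
  have hd : ∀ z ∈ Ω, HasFDerivAt f (fderiv ℝ f z) z := fun z hz =>
    ((hat z hz).differentiableAt (by simp)).hasFDerivAt
  obtain ⟨A, hA⟩ := hinv
  have hdx : HasFDerivAt f (A : E →L[ℝ] F) x := hA ▸ hd x hx
  let e₀ := (hat x hx).toOpenPartialHomeomorph f hdx (by simp)
  have hcont : ContinuousOn (fderiv ℝ f) Ω := hf.continuousOn_fderiv_of_isOpen hΩ (by simp)
  -- Invertible operators form an open set, so `S` is open. Restricting the local inverse to `S`
  -- makes it smooth at every point of its target, not only at `f x`.
  let S : Set E := Ω ∩ fderiv ℝ f ⁻¹' range ((↑) : (E ≃L[ℝ] F) → E →L[ℝ] F)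
  have hS : IsOpen S := hcont.isOpen_inter_preimage hΩ ContinuousLinearEquiv.isOpen
  have hxS : x ∈ S := ⟨hx, A, hA⟩
  have hsrc : (e₀.restrOpen S hS).source = e₀.source ∩ S := e₀.restrOpen_source S hS
  refine ⟨e₀.restrOpen S hS, ?_, ?_, rfl, ?_, ?_⟩
  · rw [hsrc]
    exact ⟨(hat x hx).mem_toOpenPartialHomeomorph_source hdx (by simp), hxS⟩
  · rw [hsrc]
    exact fun z hz => hz.2.1
  · rw [hsrc]
    exact fun z hz => hz.2.2
  · intro y hy
    have hz := (e₀.restrOpen S hS).map_target hy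
    rw [hsrc] at hz
    obtain ⟨B, hB⟩ := hz.2.2
    refine ((e₀.restrOpen S hS).contDiffAt_symm hy (f₀' := B) ?_ ?_).contDiffWithinAt
    · rw [hB]
      exact hd _ hz.2.1
    · exact hat _ hz.2.1

end InverseFunction

/-! ### Smoothness of postcomposition on spaces of continuous maps -/

section Superposition

variable {K : Type*} [TopologicalSpace K] [CompactSpace K]

/-- Pointwise application of continuous families of continuous linear maps. -/
noncomputable def pointwiseApply (K : Type*) [TopologicalSpace K] [CompactSpace K]
    (E F : Type*) [NormedAddCommGroup E] [NormedSpace ℝ E] [NormedAddCommGroup F]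
    [NormedSpace ℝ F] : C(K, E →L[ℝ] F) →L[ℝ] C(K, E) →L[ℝ] C(K, F) :=
  LinearMap.mkContinuous₂
    (LinearMap.mk₂ ℝ (fun (A : C(K, E →L[ℝ] F)) (u : C(K, E)) =>
        (⟨fun t => A t (u t), by fun_prop⟩ : C(K, F)))
      (fun A B u => by ext t; simp) (fun c A u => by ext t; simp)
      (fun A u v => by ext t; simp) (fun c A u => by ext t; simp)) 1 (by
    intro A u
    rw [one_mul]
    refine (ContinuousMap.norm_le _ (by positivity)).2 fun t => ?_
    exact ((A t).le_opNorm (u t)).trans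
      (mul_le_mul (A.norm_coe_le_norm t) (u.norm_coe_le_norm t) (norm_nonneg _) (norm_nonneg A)))

@[simp] theorem pointwiseApply_apply {E F : Type*} [NormedAddCommGroup E] [NormedSpace ℝ E]
    [NormedAddCommGroup F] [NormedSpace ℝ F] (A : C(K, E →L[ℝ] F)) (u : C(K, E)) (t : K) :
    pointwiseApply K E F A u t = A t (u t) := rfl

variable {E : Type u} [NormedAddCommGroup E] [NormedSpace ℝ E]

/-- The mean value inequality bounds the remainder at each `t`. Uniformity in `t` comes from
continuity of `u ↦ f' ∘ u` in the sup norm, which provides one radius `δ` for all `t`. -/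
theorem hasFDerivAt_postcomp {F : Type u} [NormedAddCommGroup F] [NormedSpace ℝ F]
    (f : C(E, F)) (f' : C(E, E →L[ℝ] F)) (hf : ∀ x, HasFDerivAt f (f' x) x) (u : C(K, E)) :
    HasFDerivAt (fun u : C(K, E) => f.comp u) (pointwiseApply K E F (f'.comp u)) u := by
  rw [hasFDerivAt_iff_isLittleO_nhds_zero, Asymptotics.isLittleO_iff]
  intro ε hε
  have hc : Continuous fun u : C(K, E) => f'.comp u := f'.continuous_postcomp
  obtain ⟨δ, hδ, h⟩ := (Metric.continuous_iff (α := C(K, E)) (β := C(K, E →L[ℝ] F))).1 hc u ε hε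
  filter_upwards [Metric.ball_mem_nhds (0 : C(K, E)) hδ] with v hv
  refine (ContinuousMap.norm_le _ (by positivity)).2 fun t => ?_
  have hvδ : ‖v‖ < δ := by simpa using hv
  have key := Convex.norm_image_sub_le_of_norm_hasFDerivWithin_le' (𝕜 := ℝ) (f := f)
    (f' := f') (φ := f' (u t)) (s := Metric.ball (u t) δ) (x := u t) (y := u t + v t) (C := ε)
    (fun x _ => (hf x).hasFDerivWithinAt) ?_ (convex_ball _ _) (Metric.mem_ball_self hδ) ?_
  · calc _ = ‖f (u t + v t) - f (u t) - f' (u t) (u t + v t - u t)‖ := by simp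
      _ ≤ ε * ‖u t + v t - u t‖ := key
      _ ≤ ε * ‖v‖ := by
        rw [add_sub_cancel_left]
        gcongr
        exact v.norm_coe_le_norm t
  · intro x hx
    -- Perturbing `u` by the constant `x - u t` moves its value at `t` to `x`, so sup-norm
    -- continuity controls `f' x - f' (u t)`.
    have hw := h (u + ContinuousMap.const K (x - u t)) (by
      rw [dist_eq_norm, add_sub_cancel_left]
      refine (ContinuousMap.norm_lt_iff _ hδ).2 fun _ => ?_
      simpa [dist_eq_norm] using hx)
    have := (ContinuousMap.dist_lt_iff hε).1 hw t
    rw [dist_eq_norm] at this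
    simpa using this.le
  · simpa using (v.norm_coe_le_norm t).trans_lt hvδ

/-- Induction on the order: the derivative is again a postcomposition, with `fderiv ℝ f`, followed
by a bounded linear map. The target changes to `E →L[ℝ] F`, so `F` is quantified inside the
induction and shares its universe with `E`. -/
theorem contDiff_postcomp_nat (m : ℕ) : ∀ {F : Type u} [NormedAddCommGroup F] [NormedSpace ℝ F]
    (f : C(E, F)), ContDiff ℝ m f → ContDiff ℝ m (fun u : C(K, E) => f.comp u) := by
  induction m with
  | zero =>
    intro F _ _ f _
    simpa [contDiff_zero] using f.continuous_postcomp
  | succ m ih =>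
    intro F _ _ f hf
    have hf' : ContDiff ℝ m (fderiv ℝ f) := hf.fderiv_right (by norm_cast)
    have hd := hasFDerivAt_postcomp (K := K) f ⟨fderiv ℝ f, hf'.continuous⟩
      fun x => (hf.differentiable (by simp) x).hasFDerivAt
    rw [Nat.cast_succ, contDiff_succ_iff_hasFDerivAt]
    exact ⟨fun u => pointwiseApply K E F ((⟨fderiv ℝ f, hf'.continuous⟩ : C(E, E →L[ℝ] F)).comp u),
      ContDiff.comp (g := pointwiseApply K E F) (ContinuousLinearMap.contDiff _)
        (ih ⟨fderiv ℝ f, hf'.continuous⟩ hf'), hd⟩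

theorem contDiff_postcomp {F : Type u} [NormedAddCommGroup F] [NormedSpace ℝ F]
    (f : C(E, F)) (hf : ContDiff ℝ ∞ f) : ContDiff ℝ ∞ (fun u : C(K, E) => f.comp u) :=
  contDiff_infty.2 fun m => contDiff_postcomp_nat m f (contDiff_infty.1 hf m)

end Superposition

/-! ### Smooth local flows by the inverse function theorem on path space -/

section Flow

variable {E : Type u} [NormedAddCommGroup E] [NormedSpace ℝ E]

/-- The constant path, as a continuous linear map. -/
noncomputable def constPath (E : Type*) [NormedAddCommGroup E] [NormedSpace ℝ E] :
    E →L[ℝ] C(unitInterval, E) :=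
  LinearMap.mkContinuous
    { toFun := ContinuousMap.const unitInterval
      map_add' := fun _ _ => rfl
      map_smul' := fun _ _ => rfl } 1 fun x => by
    rw [one_mul]
    exact (ContinuousMap.norm_le _ (norm_nonneg _)).2 fun _ => le_rfl

@[simp] theorem constPath_apply (x : E) (t : unitInterval) : constPath E x t = x := rfl

theorem continuous_extend {E : Type*} [TopologicalSpace E] (u : C(unitInterval, E)) :
    Continuous fun s : ℝ => u (projIcc 0 1 zero_le_one s) :=
  u.continuous.comp continuous_projIcc

variable [CompleteSpace E]

theorem hasDerivAt_integral_extend (u : C(unitInterval, E)) (t : ℝ) :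
    HasDerivAt (fun t : ℝ => ∫ s in (0 : ℝ)..t, u (projIcc 0 1 zero_le_one s))
      (u (projIcc 0 1 zero_le_one t)) t :=
  (continuous_extend u).integral_hasStrictDerivAt 0 t |>.hasDerivAt

/-- The Volterra operator `u ↦ ∫₀ᵗ u`. -/
noncomputable def volterra (E : Type*) [NormedAddCommGroup E] [NormedSpace ℝ E]
    [CompleteSpace E] : C(unitInterval, E) →L[ℝ] C(unitInterval, E) :=
  LinearMap.mkContinuous
    { toFun := fun u =>
        { toFun := fun t => ∫ s in (0 : ℝ)..t, u (projIcc 0 1 zero_le_one s)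
          continuous_toFun :=
            (continuous_iff_continuousAt.2 fun t =>
              (hasDerivAt_integral_extend u t).continuousAt).comp continuous_subtype_val }
      map_add' := fun u v => by
        ext t
        exact intervalIntegral.integral_add ((continuous_extend u).intervalIntegrable _ _)
          ((continuous_extend v).intervalIntegrable _ _)
      map_smul' := fun c u => by
        ext t
        exact intervalIntegral.integral_smul c _ } 1 fun u => by
    rw [one_mul]
    refine (ContinuousMap.norm_le _ (norm_nonneg u)).2 fun t => ?_
    refine (intervalIntegral.norm_integral_le_of_norm_le_const
      (fun s _ => u.norm_coe_le_norm (projIcc 0 1 zero_le_one s))).trans ?_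
    rw [sub_zero, abs_of_nonneg t.2.1]
    exact mul_le_of_le_one_right (norm_nonneg u) t.2.2

/-- The defect of the integral equation `u(t) = y + s ∫₀ᵗ X(u)`. -/
noncomputable def integralDefect (X : C(E, E)) (p : (ℝ × E) × C(unitInterval, E)) :
    C(unitInterval, E) :=
  p.2 - constPath E p.1.2 - p.1.1 • volterra E (X.comp p.2)

theorem integralDefect_eq_zero_iff (X : C(E, E)) (s : ℝ) (y : E) (u : C(unitInterval, E)) :
    integralDefect X ((s, y), u) = 0 ↔
      ∀ t : unitInterval, u t = y + s • ∫ τ in (0 : ℝ)..t, X (u (projIcc 0 1 zero_le_one τ)) := by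
  rw [ContinuousMap.ext_iff]
  refine forall_congr' fun t => ?_
  change u t - y - s • _ = 0 ↔ _
  rw [sub_sub, sub_eq_zero]
  rfl

theorem contDiff_integralDefect (X : C(E, E)) (hX : ContDiff ℝ ∞ X) :
    ContDiff ℝ ∞ (integralDefect X) := by
  have h1 : ContDiff ℝ ∞ fun p : (ℝ × E) × C(unitInterval, E) => X.comp p.2 :=
    (contDiff_postcomp X hX).comp contDiff_snd
  have h2 : ContDiff ℝ ∞ fun p : (ℝ × E) × C(unitInterval, E) => volterra E (X.comp p.2) :=
    (volterra E).contDiff.comp h1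
  have h3 : ContDiff ℝ ∞ fun p : (ℝ × E) × C(unitInterval, E) => constPath E p.1.2 :=
    (constPath E).contDiff.comp (contDiff_snd.comp contDiff_fst)
  exact (contDiff_snd.sub h3).sub ((contDiff_fst.comp contDiff_fst).smul h2)

/-- Rescaling time in a solution of the integral equation. -/
theorem integralDefect_rescale (X : C(E, E)) {s : ℝ} {y : E} {u : C(unitInterval, E)}
    (h : integralDefect X ((s, y), u) = 0) (r : unitInterval) :
    integralDefect X ((s * r, y), u.comp ⟨fun t => r * t, by fun_prop⟩) = 0 := by
  rw [integralDefect_eq_zero_iff] at h ⊢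
  intro t
  change u (r * t) = _
  rw [h (r * t), mul_smul, show ((r * t : unitInterval) : ℝ) = r * t from rfl]
  congr 2
  have := intervalIntegral.smul_integral_comp_mul_left (a := 0) (b := (t : ℝ))
    (fun τ => X (u (projIcc 0 1 zero_le_one τ))) (r : ℝ)
  rw [mul_zero] at this
  rw [← this]
  congr 1
  refine intervalIntegral.integral_congr fun τ hτ => ?_
  rw [uIcc_of_le t.2.1] at hτ
  have hτ1 : τ ∈ Icc (0 : ℝ) 1 := ⟨hτ.1, hτ.2.trans t.2.2⟩
  have hrτ : (r : ℝ) * τ ∈ Icc (0 : ℝ) 1 :=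
    ⟨mul_nonneg r.2.1 hτ1.1, mul_le_one₀ r.2.2 hτ1.1 hτ1.2⟩
  change X (u _) = X (u (r * _))
  rw [projIcc_of_mem zero_le_one hrτ, projIcc_of_mem zero_le_one hτ1]
  rfl

/-- At `s = 0` the factor `s` kills the derivative of the Volterra term in the path variable. The
differential is therefore block triangular with identities on the diagonal, and its inverse is
obtained by changing the sign of the off-diagonal block. -/
theorem fderiv_prod_integralDefect_isInvertible (X : C(E, E)) (hX : ContDiff ℝ ∞ X) (y : E) :
    (fderiv ℝ (fun p => (p.1, integralDefect X p)) ((0, y), constPath E y)).IsInvertible := by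
  set p₀ : (ℝ × E) × C(unitInterval, E) := ((0, y), constPath E y)
  have h2 : ContDiff ℝ ∞ fun p : (ℝ × E) × C(unitInterval, E) => volterra E (X.comp p.2) :=
    (volterra E).contDiff.comp ((contDiff_postcomp X hX).comp contDiff_snd)
  let A : ℝ × E →L[ℝ] C(unitInterval, E) :=
    (constPath E).comp (ContinuousLinearMap.snd ℝ ℝ E) +
      (ContinuousLinearMap.fst ℝ ℝ E).smulRight (volterra E (X.comp (constPath E y)))
  let π₁ := ContinuousLinearMap.fst ℝ (ℝ × E) C(unitInterval, E)
  let π₂ := ContinuousLinearMap.snd ℝ (ℝ × E) C(unitInterval, E)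
  have hd : HasFDerivAt (integralDefect X) (π₂ - A.comp π₁) p₀ := by
    have hv := (h2.differentiable (by simp) p₀).hasFDerivAt
    have hs : HasFDerivAt (fun p : (ℝ × E) × C(unitInterval, E) => p.1.1)
        ((ContinuousLinearMap.fst ℝ ℝ E).comp π₁) p₀ :=
      ContinuousLinearMap.hasFDerivAt ((ContinuousLinearMap.fst ℝ ℝ E).comp π₁)
    have hc : HasFDerivAt (fun p : (ℝ × E) × C(unitInterval, E) => constPath E p.1.2)
        ((constPath E).comp ((ContinuousLinearMap.snd ℝ ℝ E).comp π₁)) p₀ :=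
      ContinuousLinearMap.hasFDerivAt
        ((constPath E).comp ((ContinuousLinearMap.snd ℝ ℝ E).comp π₁))
    have hu : HasFDerivAt (fun p : (ℝ × E) × C(unitInterval, E) => p.2) π₂ p₀ :=
      ContinuousLinearMap.hasFDerivAt π₂
    refine ((hu.sub hc).sub (hs.smul hv)).congr_fderiv ?_
    refine ContinuousLinearMap.ext fun q => ?_
    have h0 : p₀.1.1 = 0 := rfl
    simp only [sub_apply, add_apply, ContinuousLinearMap.comp_apply,
      ContinuousLinearMap.smulRight_apply, h0, zero_smul, zero_add, A, sub_sub]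
    rfl
  have hΘ : HasFDerivAt (fun p => (p.1, integralDefect X p)) (π₁.prod (π₂ - A.comp π₁)) p₀ :=
    HasFDerivAt.prodMk (ContinuousLinearMap.hasFDerivAt π₁) hd
  rw [hΘ.fderiv]
  refine ContinuousLinearMap.IsInvertible.of_inverse (g := π₁.prod (π₂ + A.comp π₁)) ?_ ?_ <;>
  · refine ContinuousLinearMap.ext fun q => Prod.ext rfl ?_
    simp [π₁, π₂]

/-- Smooth dependence of local solutions on the initial value: a smooth vector field has a smooth
local flow. -/
theorem exists_local_flow (X : E → E) (hX : ContDiff ℝ ∞ X) (y₀ : E) :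
    ∃ (Φ : ℝ × E → E) (W : Set (ℝ × E)), IsOpen W ∧ (0, y₀) ∈ W ∧ ContDiffOn ℝ ∞ Φ W ∧
      (∀ p ∈ W, p.1 = 0 → Φ p = p.2) ∧ ∀ p ∈ W, fderiv ℝ Φ p (1, 0) = X (Φ p) := by
  let X' : C(E, E) := ⟨X, hX.continuous⟩
  -- Keeping `(s, y)` as a component turns the inverse function theorem into an implicit one. Time
  -- enters as the parameter `s`: the solution of the rescaled equation evaluated at `1` is the flow
  -- at time `s`.
  let Θ : (ℝ × E) × C(unitInterval, E) → (ℝ × E) × C(unitInterval, E) :=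
    fun p => (p.1, integralDefect X' p)
  have hΘ : ContDiff ℝ ∞ Θ := contDiff_fst.prodMk (contDiff_integralDefect X' hX)
  obtain ⟨e, he₀, -, heΘ, -, hsymm⟩ := exists_openPartialHomeomorph_of_contDiffOn isOpen_univ
    hΘ.contDiffOn (mem_univ ((0, y₀), constPath E y₀))
    (fderiv_prod_integralDefect_isInvertible X' hX y₀)
  have hconst : ∀ y, integralDefect X' ((0, y), constPath E y) = 0 := fun y => by
    rw [integralDefect_eq_zero_iff]
    intro t
    simp
  let ι : ℝ × E → (ℝ × E) × C(unitInterval, E) := fun p => (p, 0)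
  have hι : ContDiff ℝ ∞ ι := contDiff_id.prodMk contDiff_const
  let W : Set (ℝ × E) := ι ⁻¹' e.target
  have hW : IsOpen W := e.open_target.preimage hι.continuous
  let sol : ℝ × E → C(unitInterval, E) := fun p => (e.symm (ι p)).2
  have hsol : ContDiffOn ℝ ∞ sol W :=
    contDiff_snd.comp_contDiffOn (hsymm.comp hι.contDiffOn fun p hp => hp)
  let ev : C(unitInterval, E) →L[ℝ] E := ContinuousMap.evalCLM ℝ 1
  let Φ : ℝ × E → E := fun p => sol p 1
  have hΦ : ContDiffOn ℝ ∞ Φ W := ev.contDiff.comp_contDiffOn hsol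
  have hinv : ∀ p ∈ W, (p, sol p) ∈ e.source ∧ integralDefect X' (p, sol p) = 0 := by
    intro p hp
    have h1 : Θ (e.symm (ι p)) = ι p := by rw [← heΘ]; exact e.right_inv hp
    have h2 : (e.symm (ι p)).1 = p := congrArg Prod.fst h1
    have h3 : e.symm (ι p) = (p, sol p) := Prod.ext h2 rfl
    have h4 : integralDefect X' (e.symm (ι p)) = 0 := congrArg Prod.snd h1
    rw [h3] at h4
    exact ⟨h3 ▸ e.map_target hp, h4⟩
  -- Uniqueness of solutions is only available near the constant path, as injectivity of `e` on its
  -- source.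
  have huniq : ∀ p u, (p, u) ∈ e.source → integralDefect X' (p, u) = 0 → sol p = u := by
    intro p u hs h0
    have h1 : e (p, u) = ι p := by
      rw [heΘ]
      exact Prod.ext rfl h0
    change (e.symm (ι p)).2 = u
    rw [← h1, e.left_inv hs]
  have hzero : ∀ p ∈ W, p.1 = 0 → Φ p = p.2 := by
    rintro ⟨s, y⟩ hp (rfl : s = 0)
    have := (integralDefect_eq_zero_iff X' 0 y _).1 (hinv _ hp).2 1
    rwa [zero_smul, add_zero] at this
  have h0W : ((0 : ℝ), y₀) ∈ W := by
    have h1 : e ((0, y₀), constPath E y₀) = ι (0, y₀) := by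
      rw [heΘ]
      exact Prod.ext rfl (hconst y₀)
    change ι (0, y₀) ∈ e.target
    rw [← h1]
    exact e.map_source he₀
  refine ⟨Φ, W, hW, h0W, hΦ, hzero, ?_⟩
  have hdiff : ∀ p ∈ W, HasFDerivAt Φ (fderiv ℝ Φ p) p := fun p hp =>
    ((hΦ.contDiffAt (hW.mem_nhds hp)).differentiableAt (by simp)).hasFDerivAt
  -- For `r` near `1` the path `t ↦ w (r * t)` solves the equation with time parameter `s * r` and
  -- stays in `e.source`, so uniqueness gives `Φ (s * r, y) = w r`. Comparing one-sided derivatives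
  -- at `r = 1`, the end of the interval, and cancelling `s` gives the flow equation.
  have hne : ∀ p ∈ W, p.1 ≠ 0 → fderiv ℝ Φ p (1, 0) = X (Φ p) := by
    rintro ⟨s, y⟩ hp (hs : s ≠ 0)
    obtain ⟨hsrc, hdef⟩ := hinv _ hp
    set w := sol (s, y) with hw
    let scaled : unitInterval → C(unitInterval, E) :=
      fun r => w.comp ⟨fun t => r * t, by fun_prop⟩
    have hcont : Continuous fun r : unitInterval => (((s * r, y) : ℝ × E), scaled r) := by
      refine Continuous.prodMk (by fun_prop) ?_
      exact ContinuousMap.continuous_of_continuous_uncurry _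
        (w.continuous.comp (by fun_prop : Continuous fun q : unitInterval × unitInterval => q.1 * q.2))
    have hone : scaled 1 = w := ContinuousMap.ext fun t => congrArg w (one_mul t)
    have hev : ∀ᶠ r : unitInterval in 𝓝 1, Φ (s * r, y) = w r := by
      have hmem : (((s * (1 : unitInterval), y) : ℝ × E), scaled 1) ∈ e.source := by
        rw [hone]
        simpa using hsrc
      filter_upwards [hcont.continuousAt.preimage_mem_nhds (e.open_source.mem_nhds hmem)] with r hr
      have := huniq _ _ hr (integralDefect_rescale X' hdef r)
      change sol (s * r, y) 1 = w r
      rw [this]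
      exact congrArg w (mul_one r)
    have hw1 : HasDerivWithinAt (fun r : ℝ => y + s • ∫ τ in (0 : ℝ)..r,
        X' (w (projIcc 0 1 zero_le_one τ))) (s • X (w 1)) (Icc 0 1) 1 := by
      have := hasDerivAt_integral_extend (X'.comp w) 1
      rw [projIcc_right] at this
      exact ((this.const_smul s).const_add y).hasDerivWithinAt
    have hΦ1 : HasDerivWithinAt (fun r : ℝ => Φ (s * r, y)) (s • fderiv ℝ Φ (s, y) (1, 0))
        (Icc 0 1) 1 := by
      have hc : HasDerivAt (fun r : ℝ => ((s * r, y) : ℝ × E)) (s * 1, 0) 1 :=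
        HasDerivAt.prodMk ((hasDerivAt_id (1 : ℝ)).const_mul s) (hasDerivAt_const _ _)
      have hd := hdiff _ hp
      have := HasFDerivAt.comp_hasDerivAt (f := fun r : ℝ => ((s * r, y) : ℝ × E)) 1
        (l := Φ) (l' := fderiv ℝ Φ (s, y)) (by simpa using hd) hc
      rw [show ((s * 1, (0 : E)) : ℝ × E) = s • (1, 0) by simp, map_smul] at this
      exact this.hasDerivWithinAt
    have heq : (fun r : ℝ => Φ (s * r, y)) =ᶠ[𝓝[Icc 0 1] 1] fun r : ℝ => y + s • ∫ τ in (0 : ℝ)..r,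
        X' (w (projIcc 0 1 zero_le_one τ)) := by
      rw [nhdsWithin_eq_map_subtype_coe (right_mem_Icc.2 (zero_le_one' ℝ))]
      refine eventually_map.2 (hev.mono fun r hr => ?_)
      exact hr.trans ((integralDefect_eq_zero_iff X' s y w).1 hdef r)
    have hu : UniqueDiffWithinAt ℝ (Icc (0 : ℝ) 1) 1 :=
      uniqueDiffOn_Icc zero_lt_one _ (right_mem_Icc.2 zero_le_one)
    have := hu.eq_deriv _ (hΦ1.congr_of_eventuallyEq_of_mem heq.symm
      (right_mem_Icc.2 zero_le_one)) hw1
    exact smul_right_injective E hs this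
  rintro ⟨s, y⟩ hp
  by_cases hs : s = 0
  · subst hs
    -- At `s = 0` the factor `s` cannot be cancelled; both sides are continuous, so the equation
    -- passes to the limit.
    have hline : Tendsto (fun s : ℝ => (s, y)) (𝓝[≠] 0) (𝓝 (0, y)) :=
      (Continuous.tendsto (by fun_prop) 0).mono_left nhdsWithin_le_nhds
    have hc1 : ContinuousAt (fun p => fderiv ℝ Φ p (1, 0)) (0, y) :=
      (((hΦ.continuousOn_fderiv_of_isOpen hW (by simp)).clm_apply continuousOn_const).continuousAt
        (hW.mem_nhds hp))
    have hc2 : ContinuousAt (fun p => X (Φ p)) (0, y) :=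
      hX.continuous.continuousAt.comp (hΦ.continuousOn.continuousAt (hW.mem_nhds hp))
    refine tendsto_nhds_unique (hc1.tendsto.comp hline) ((hc2.tendsto.comp hline).congr' ?_)
    filter_upwards [hline (hW.mem_nhds hp), self_mem_nhdsWithin] with s hs hs0
    exact (hne _ hs hs0).symm
  · exact hne _ hp hs

end Flow

/-! ### Flow boxes and first integrals -/

section FirstIntegral

variable {E : Type u} [NormedAddCommGroup E] [NormedSpace ℝ E] [FiniteDimensional ℝ E]

/-- A vector field that is smooth near a point agrees near that point with a smooth one. -/
theorem exists_contDiff_eventuallyEq {X : E → E} {Ω : Set E} (hΩ : IsOpen Ω)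
    (hX : ContDiffOn ℝ ∞ X Ω) {y₀ : E} (hy : y₀ ∈ Ω) :
    ∃ X' : E → E, ContDiff ℝ ∞ X' ∧ X' =ᶠ[𝓝 y₀] X := by
  obtain ⟨r, hr, hball⟩ := Metric.isOpen_iff.1 hΩ y₀ hy
  let f : ContDiffBump y₀ := ⟨r / 4, r / 2, by positivity, by linarith⟩
  refine ⟨fun y => f y • X y, contDiff_iff_contDiffAt.2 fun y => ?_, ?_⟩
  · by_cases hy : y ∉ tsupport fun y => f y • X y
    · exact contDiffAt_const.congr_of_eventuallyEq (notMem_tsupport_iff_eventuallyEq.1 hy)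
    rw [not_not] at hy
    have h1 : y ∈ tsupport f := tsupport_smul_subset_left f X hy
    rw [f.tsupport_eq] at h1
    have h2 : y ∈ Ω := hball (Metric.closedBall_subset_ball (by simp [f]; linarith) h1)
    exact f.contDiffAt.smul (hX.contDiffAt (hΩ.mem_nhds h2))
  · filter_upwards [f.eventuallyEq_one] with y h
    simp [h]

/-- Near a point where a smooth vector field is transverse to the hyperplane `ker ℓ`, it has a
complete set of smooth first integrals. -/
theorem exists_first_integral {X : E → E} {Ω : Set E} (hΩ : IsOpen Ω)
    (hX : ContDiffOn ℝ ∞ X Ω) {y₀ : E} (hy : y₀ ∈ Ω) (ℓ : E →L[ℝ] ℝ) (hℓ : ℓ (X y₀) = 1) :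
    ∃ (U : Set E) (ξ : E → ℓ.ker), IsOpen U ∧ y₀ ∈ U ∧ U ⊆ Ω ∧
      ContDiffOn ℝ ∞ ξ U ∧ (∀ y ∈ U, fderiv ℝ ξ y (X y) = 0) ∧
      ∀ v, fderiv ℝ ξ y₀ v = 0 → ℓ v = 0 → v = 0 := by
  have : CompleteSpace E := FiniteDimensional.complete ℝ E
  obtain ⟨X', hX', hXX'⟩ := exists_contDiff_eventuallyEq hΩ hX hy
  obtain ⟨Φ, W, hW, h0W, hΦ, hΦ0, hΦX⟩ := exists_local_flow X' hX' y₀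
  let inc : ℝ × ℓ.ker →L[ℝ] ℝ × E :=
    (ContinuousLinearMap.id ℝ ℝ).prodMap ℓ.ker.subtypeL
  -- `Φ ∘ κ` is the flow box `(s, v) ↦ Φ (s, y₀ + v)`, which flows out of the hyperplane through
  -- `y₀` parallel to `ker ℓ`.
  let κ : ℝ × ℓ.ker → ℝ × E := fun p => (0, y₀) + inc p
  have hκ : ∀ p, HasFDerivAt κ inc p := fun p => inc.hasFDerivAt.const_add _
  have hκs : ContDiff ℝ ∞ κ := contDiff_const.add inc.contDiff
  have hκ0 : κ 0 = (0, y₀) := by simp [κ]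
  let V : Set (ℝ × ℓ.ker) := κ ⁻¹' W
  have hV : IsOpen V := hW.preimage hκs.continuous
  have h0V : (0 : ℝ × ℓ.ker) ∈ V := by
    change κ 0 ∈ W
    rwa [hκ0]
  have hΨ : ContDiffOn ℝ ∞ (Φ ∘ κ) V := hΦ.comp hκs.contDiffOn fun p hp => hp
  have hΦd : ∀ p ∈ W, HasFDerivAt Φ (fderiv ℝ Φ p) p := fun p hp =>
    ((hΦ.contDiffAt (hW.mem_nhds hp)).differentiableAt (by simp)).hasFDerivAt
  have hΨd : ∀ p ∈ V, fderiv ℝ (Φ ∘ κ) p = (fderiv ℝ Φ (κ p)).comp inc := fun p hp =>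
    ((hΦd _ hp).comp p (hκ p)).fderiv
  have hΦy : ∀ w, fderiv ℝ Φ (0, y₀) (0, w) = w := by
    intro w
    have h1 : HasFDerivAt (fun y : E => Φ (0, y))
        ((fderiv ℝ Φ (0, y₀)).comp (ContinuousLinearMap.inr ℝ ℝ E)) y₀ :=
      (hΦd _ h0W).comp y₀ (hasFDerivAt_prodMk_right 0 y₀)
    have h2 : (fun y : E => Φ (0, y)) =ᶠ[𝓝 y₀] id := by
      have : Continuous fun y : E => ((0 : ℝ), y) := by fun_prop
      filter_upwards [this.continuousAt.preimage_mem_nhds (hW.mem_nhds h0W)] with y hy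
      exact hΦ0 _ hy rfl
    have h3 := h1.unique ((hasFDerivAt_id y₀).congr_of_eventuallyEq h2)
    exact DFunLike.congr_fun h3 w
  have hXy : X' y₀ = X y₀ := hXX'.self_of_nhds
  have hΨ0 : ∀ q : ℝ × ℓ.ker, fderiv ℝ (Φ ∘ κ) 0 q = q.1 • X y₀ + q.2 := by
    intro q
    rw [hΨd _ h0V, hκ0]
    have h1 : inc q = q.1 • ((1 : ℝ), (0 : E)) + (0, (q.2 : E)) := Prod.ext (by simp [inc]) (by simp [inc])
    rw [ContinuousLinearMap.comp_apply, h1, map_add, map_smul, hΦy, hΦX _ h0W, hΦ0 _ h0W rfl, hXy]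
  have hinv : (fderiv ℝ (Φ ∘ κ) 0).IsInvertible := by
    -- The splitting of `E` into the line through `X y₀` and `ker ℓ`; it inverts `(s, v) ↦ s • X y₀
    -- + v` because `ℓ (X y₀) = 1`.
    let B : E →L[ℝ] ℝ × ℓ.ker := ℓ.prod
      ((ContinuousLinearMap.id ℝ E - ℓ.smulRight (X y₀)).codRestrict ℓ.ker fun v => by
        simp [hℓ])
    refine ContinuousLinearMap.IsInvertible.of_inverse (g := B) ?_ ?_
    · refine ContinuousLinearMap.ext fun v => ?_
      rw [ContinuousLinearMap.comp_apply, hΨ0]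
      simp [B]
    · refine ContinuousLinearMap.ext fun q => ?_
      have hq : ℓ (q.2 : E) = 0 := q.2.2
      rw [ContinuousLinearMap.comp_apply, hΨ0]
      refine Prod.ext ?_ (Subtype.ext ?_)
      · simp [B, hℓ, hq]
      · simp [B, hℓ, hq]
  obtain ⟨e, h0e, heV, heΨ, hein, hsymm⟩ :=
    exists_openPartialHomeomorph_of_contDiffOn hV hΨ h0V hinv
  have hy0 : e 0 = y₀ := by
    rw [heΨ, Function.comp_apply, hκ0]
    exact hΦ0 _ h0W rfl
  have hy0t : y₀ ∈ e.target := hy0 ▸ e.map_source h0e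
  have hsymm0 : e.symm y₀ = 0 := by rw [← hy0, e.left_inv h0e]
  obtain ⟨N, hN, hNo, hyN⟩ := mem_nhds_iff.1 hXX'
  have hed : ∀ y ∈ e.target, ∃ B : (ℝ × ℓ.ker) ≃L[ℝ] E,
      (B : ℝ × ℓ.ker →L[ℝ] E) = fderiv ℝ (Φ ∘ κ) (e.symm y) ∧
      HasFDerivAt e.symm (B.symm : E →L[ℝ] ℝ × ℓ.ker) y := by
    intro y hy
    obtain ⟨B, hB⟩ := hein _ (e.map_target hy)
    refine ⟨B, hB, e.hasFDerivAt_symm hy ?_⟩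
    rw [hB, heΨ]
    exact ((hΨ.contDiffAt (hV.mem_nhds (heV (e.map_target hy)))).differentiableAt
      (by simp)).hasFDerivAt
  have hξd : ∀ y ∈ e.target, ∀ v, ∃ B : (ℝ × ℓ.ker) ≃L[ℝ] E,
      (B : ℝ × ℓ.ker →L[ℝ] E) = fderiv ℝ (Φ ∘ κ) (e.symm y) ∧
      fderiv ℝ (fun y => (e.symm y).2) y v = (B.symm v).2 := by
    intro y hy v
    obtain ⟨B, hB, hd⟩ := hed y hy
    refine ⟨B, hB, ?_⟩
    rw [hd.snd.fderiv]
    rfl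
  -- `ξ` is the inverse flow box with the time coordinate dropped, hence constant along the flow.
  -- Intersecting with `N`, where `X' = X`, transfers this to the original field.
  refine ⟨e.target ∩ N ∩ Ω, fun y => (e.symm y).2, (e.open_target.inter hNo).inter hΩ,
    ⟨⟨hy0t, hyN⟩, hy⟩, inter_subset_right, ?_, ?_, ?_⟩
  · exact contDiff_snd.comp_contDiffOn (hsymm.mono fun y hy => hy.1.1)
  · rintro y ⟨⟨hyt, hyN⟩, -⟩
    obtain ⟨B, hB, h⟩ := hξd y hyt (X y)
    have hp : e.symm y ∈ V := heV (e.map_target hyt)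
    have h1 : B (1, 0) = X y := by
      have h2 : B (1, 0) = fderiv ℝ (Φ ∘ κ) (e.symm y) (1, 0) := by rw [← hB]; rfl
      have h3 : Φ (κ (e.symm y)) = y := by
        have := e.right_inv hyt
        rwa [heΨ] at this
      have h4 : inc (1, 0) = (1, 0) := by simp [inc]
      have h5 : X' y = X y := hN hyN
      rw [h2, hΨd _ hp, ContinuousLinearMap.comp_apply, h4, hΦX _ hp, h3, h5]
    rw [h, ← h1, B.symm_apply_apply]
  · intro v hv hℓv
    obtain ⟨B, hB, h⟩ := hξd y₀ hy0t v
    rw [hv] at h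
    have h1 : v = B (B.symm v) := (B.apply_symm_apply v).symm
    have h2 : B (B.symm v) = (B.symm v).1 • X y₀ + (B.symm v).2 := by
      rw [← hΨ0, ← hsymm0, ← hB]
      rfl
    rw [h2, ← h, Submodule.coe_zero, add_zero] at h1
    have h3 : (B.symm v).1 = 0 := by
      have := congrArg ℓ h1
      rwa [hℓv, map_smul, hℓ, smul_eq_mul, mul_one, eq_comm] at this
    rw [h1, h3, zero_smul]

end FirstIntegral

/-! ### The task gradient and the orthogonal complement of the kernel -/

section Charts

variable {n : ℕ} {Q : Type u} [TopologicalSpace Q] [ChartedSpace (EuclideanSpace ℝ (Fin n)) Q]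

theorem mdifferentiable_of_mem_maximalAtlas
    {φ : OpenPartialHomeomorph Q (EuclideanSpace ℝ (Fin n))}
    (hφ : φ ∈ IsManifold.maximalAtlas (𝓡 n) ∞ Q) : φ.MDifferentiable (𝓡 n) (𝓡 n) :=
  ⟨(contMDiffOn_of_mem_maximalAtlas hφ).mdifferentiableOn (by simp),
    (contMDiffOn_symm_of_mem_maximalAtlas hφ).mdifferentiableOn (by simp)⟩

end Charts

section TaskGradient

variable {n : ℕ}
  {Q : Type u} [TopologicalSpace Q] [ChartedSpace (EuclideanSpace ℝ (Fin n)) Q]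
  {M : Type v} [TopologicalSpace M] [ChartedSpace (EuclideanSpace ℝ (Fin 1)) M]

/-- The coordinate of a point of the one-dimensional Euclidean space. -/
noncomputable def coordZero : EuclideanSpace ℝ (Fin 1) →L[ℝ] ℝ := EuclideanSpace.proj 0

theorem coordZero_eq_zero_iff (v : EuclideanSpace ℝ (Fin 1)) : coordZero v = 0 ↔ v = 0 := by
  refine ⟨fun h => PiLp.ext fun i => ?_, fun h => by rw [h, map_zero]⟩
  rw [Subsingleton.elim i 0]
  exact h

theorem contMDiffOn_taskCoord {H : Q → M} (hH : ContMDiff (𝓡 n) (𝓡 1) ∞ H)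
    {x : OpenPartialHomeomorph M (EuclideanSpace ℝ (Fin 1))}
    (hx : x ∈ IsManifold.maximalAtlas (𝓡 1) ∞ M) :
    ContMDiffOn (𝓡 n) 𝓘(ℝ, ℝ) ∞ (taskCoord (m := 1) H x 0) (H ⁻¹' x.source) :=
  coordZero.contMDiff.comp_contMDiffOn
    ((contMDiffOn_of_mem_maximalAtlas hx).comp hH.contMDiffOn fun _ hq => hq)

/-- By the chain rule `dh` is `dH` followed by the differential of the chart and the only coordinate
of `ℝ¹`, both injective. -/
theorem mfderiv_taskCoord_eq_zero_iff {H : Q → M} (hH : ContMDiff (𝓡 n) (𝓡 1) ∞ H)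
    {x : OpenPartialHomeomorph M (EuclideanSpace ℝ (Fin 1))}
    (hx : x ∈ IsManifold.maximalAtlas (𝓡 1) ∞ M) {q : Q} (hq : H q ∈ x.source)
    (v : TangentSpace (𝓡 n) q) :
    mfderiv (𝓡 n) 𝓘(ℝ, ℝ) (taskCoord (m := 1) H x 0) q v = 0 ↔
      mfderiv (𝓡 n) (𝓡 1) H q v = 0 := by
  have hxd := mdifferentiable_of_mem_maximalAtlas hx
  have h1 : HasMFDerivAt (𝓡 n) (𝓡 1) H q (mfderiv (𝓡 n) (𝓡 1) H q) :=
    (hH.mdifferentiable (by simp) q).hasMFDerivAt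
  have h2 : HasMFDerivAt (𝓡 1) (𝓡 1) x (H q) (mfderiv (𝓡 1) (𝓡 1) x (H q)) :=
    (hxd.mdifferentiableAt hq).hasMFDerivAt
  have h3 : HasMFDerivAt (𝓡 1) 𝓘(ℝ, ℝ) coordZero (x (H q)) coordZero :=
    coordZero.hasMFDerivAt
  have h4 := (h3.comp q (h2.comp q h1)).mfderiv
  have h5 : mfderiv (𝓡 n) 𝓘(ℝ, ℝ) (taskCoord (m := 1) H x 0) q v =
      coordZero (mfderiv (𝓡 1) (𝓡 1) x (H q) (mfderiv (𝓡 n) (𝓡 1) H q v)) :=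
    DFunLike.congr_fun h4 v
  rw [h5]
  refine (coordZero_eq_zero_iff _).trans ?_
  exact map_eq_zero_iff _ (hxd.mfderiv_injective hq)

variable [IsManifold (𝓡 n) ∞ Q]

theorem gradient_taskCoord_ne_zero (g : Metric n Q) {H : Q → M}
    (hH : ContMDiff (𝓡 n) (𝓡 1) ∞ H) {x : OpenPartialHomeomorph M (EuclideanSpace ℝ (Fin 1))}
    (hx : x ∈ IsManifold.maximalAtlas (𝓡 1) ∞ M) {q : Q} (hq : H q ∈ x.source)
    (hsub : Function.Surjective (mfderiv (𝓡 n) (𝓡 1) H q)) :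
    gradient g (taskCoord (m := 1) H x 0) q ≠ 0 := by
  intro h0
  have h1 : ∀ v, mfderiv (𝓡 n) (𝓡 1) H q v = 0 := fun v => by
    rw [← mfderiv_taskCoord_eq_zero_iff hH hx hq, ← inner_gradient g, h0, map_zero]
    rfl
  have : Nontrivial (TangentSpace (𝓡 1) (H q)) :=
    inferInstanceAs (Nontrivial (EuclideanSpace ℝ (Fin 1)))
  obtain ⟨w, hw⟩ := exists_ne (0 : TangentSpace (𝓡 1) (H q))
  obtain ⟨v, rfl⟩ := hsub w
  exact hw (h1 v)

theorem mfderiv_taskCoord_gradient_pos (g : Metric n Q) {H : Q → M}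
    (hH : ContMDiff (𝓡 n) (𝓡 1) ∞ H) {x : OpenPartialHomeomorph M (EuclideanSpace ℝ (Fin 1))}
    (hx : x ∈ IsManifold.maximalAtlas (𝓡 1) ∞ M) {q : Q} (hq : H q ∈ x.source)
    (hsub : Function.Surjective (mfderiv (𝓡 n) (𝓡 1) H q)) :
    (0 : ℝ) < mfderiv (𝓡 n) 𝓘(ℝ, ℝ) (taskCoord (m := 1) H x 0) q
      (gradient g (taskCoord (m := 1) H x 0) q) := by
  rw [← inner_gradient g]
  exact g.pos q _ (gradient_taskCoord_ne_zero g hH hx hq hsub)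

/-- At a regular point the gradient of a task coordinate spans the orthogonal complement of the
kernel of the push-forward. -/
theorem span_gradient_taskCoord (g : Metric n Q) {H : Q → M}
    (hH : ContMDiff (𝓡 n) (𝓡 1) ∞ H) {x : OpenPartialHomeomorph M (EuclideanSpace ℝ (Fin 1))}
    (hx : x ∈ IsManifold.maximalAtlas (𝓡 1) ∞ M) {q : Q} (hq : H q ∈ x.source)
    (hsub : Function.Surjective (mfderiv (𝓡 n) (𝓡 1) H q)) :
    Submodule.span ℝ {gradient g (taskCoord (m := 1) H x 0) q} =
      orthogonalComplement g q (taskTangent (m := 1) H q) := by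
  set X := gradient g (taskCoord (m := 1) H x 0) q
  let dh : TangentSpace (𝓡 n) q →L[ℝ] ℝ :=
    mfderiv (𝓡 n) 𝓘(ℝ, ℝ) (taskCoord (m := 1) H x 0) q
  have hpos : 0 < dh X := mfderiv_taskCoord_gradient_pos g hH hx hq hsub
  have hX : ∀ w, g.inner q X w = dh w := inner_gradient g _ q
  have hker : ∀ w, w ∈ taskTangent (m := 1) H q ↔ dh w = 0 := fun w =>
    (mfderiv_taskCoord_eq_zero_iff hH hx hq w).symm
  refine le_antisymm ?_ fun v hv => ?_
  · rw [Submodule.span_singleton_le_iff_mem]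
    intro w hw
    rw [hX, (hker w).1 hw]
  · have h1 : dh (v - (dh v / dh X) • X) = 0 := by
      rw [map_sub, map_smul, smul_eq_mul, div_mul_cancel₀ _ hpos.ne', sub_self]
    -- The difference lies in `ker dH`, and both `v` and `X` are orthogonal to that kernel, so the
    -- difference is orthogonal to itself.
    have h2 : g.inner q (v - (dh v / dh X) • X) (v - (dh v / dh X) • X) = 0 := by
      have h3 : g.inner q v (v - (dh v / dh X) • X) = 0 := hv _ ((hker _).2 h1)
      have h4 : g.inner q X (v - (dh v / dh X) • X) = 0 := (hX _).trans h1
      rw [(g.inner q).map_sub, (g.inner q).map_smul, sub_apply, smul_apply, h3, h4, smul_zero,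
        sub_zero]
    have h5 : v - (dh v / dh X) • X = 0 := by
      by_contra hne
      exact (g.pos q _ hne).ne' h2
    rw [sub_eq_zero.1 h5]
    exact Submodule.smul_mem _ _ (Submodule.mem_span_singleton_self X)

variable [IsManifold (𝓡 1) ∞ M]

/-- The right side does not involve a chart of `M`. This yields independence of the task coordinate
and lets a single chart be used on a whole neighbourhood, although the left side changes its chart
from point to point. -/
theorem gradientDistribution_eq_orthogonalComplement (g : Metric n Q) {H : Q → M}
    (hH : ContMDiff (𝓡 n) (𝓡 1) ∞ H) {q : Q}
    (hsub : Function.Surjective (mfderiv (𝓡 n) (𝓡 1) H q)) :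
    gradientDistribution (m := 1) g H q =
      orthogonalComplement g q (taskTangent (m := 1) H q) := by
  rw [← span_gradient_taskCoord g hH (IsManifold.chart_mem_maximalAtlas (H q))
    (mem_chart_source _ (H q)) hsub, gradientDistribution, gradientSpan, range_unique]
  rfl

end TaskGradient

/-! ### Smoothness of the metric and of gradients in a chart -/

section MetricInChart

variable {n : ℕ}
  {Q : Type u} [TopologicalSpace Q] [ChartedSpace (EuclideanSpace ℝ (Fin n)) Q]
  [IsManifold (𝓡 n) ∞ Q]

/-- The coordinate vector field of a chart in the constant direction `v` is smooth along the
inverse of the chart. -/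
theorem contMDiffOn_mfderiv_symm
    {ψ : OpenPartialHomeomorph Q (EuclideanSpace ℝ (Fin n))}
    (hψ : ψ ∈ IsManifold.maximalAtlas (𝓡 n) ∞ Q) (v : EuclideanSpace ℝ (Fin n)) :
    ContMDiffOn (𝓡 n) (𝓡 n).tangent ∞
      (fun y => (⟨ψ.symm y, mfderiv (𝓡 n) (𝓡 n) ψ.symm y v⟩ : TangentBundle (𝓡 n) Q))
      ψ.target := by
  have h1 := (contMDiffOn_symm_of_mem_maximalAtlas hψ).contMDiffOn_tangentMapWithin (m := ∞)
    le_rfl ψ.open_target.uniqueMDiffOn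
  have h2 : ContMDiff (𝓡 n) (𝓡 n).tangent ∞ (fun y : EuclideanSpace ℝ (Fin n) =>
      (⟨y, v⟩ : TangentBundle (𝓡 n) (EuclideanSpace ℝ (Fin n)))) :=
    contMDiff_vectorSpace_iff_contDiff.2 contDiff_const
  refine (h1.comp h2.contMDiffOn fun y hy => hy).congr fun y hy => ?_
  change _ = (⟨ψ.symm y, mfderivWithin (𝓡 n) (𝓡 n) ψ.symm ψ.target y v⟩ : TangentBundle (𝓡 n) Q)
  rw [mfderivWithin_of_isOpen ψ.open_target hy]

/-- The coordinate expression of the metric in a chart. -/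
noncomputable def metricInChart (g : Metric n Q)
    (ψ : OpenPartialHomeomorph Q (EuclideanSpace ℝ (Fin n))) (y : EuclideanSpace ℝ (Fin n)) :
    EuclideanSpace ℝ (Fin n) →L[ℝ] EuclideanSpace ℝ (Fin n) →L[ℝ] ℝ :=
  let B : EuclideanSpace ℝ (Fin n) →L[ℝ] EuclideanSpace ℝ (Fin n) →L[ℝ] ℝ := g.inner (ψ.symm y)
  let A : EuclideanSpace ℝ (Fin n) →L[ℝ] EuclideanSpace ℝ (Fin n) :=
    mfderiv (𝓡 n) (𝓡 n) ψ.symm y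
  B.bilinearComp A A

theorem metricInChart_apply (g : Metric n Q)
    (ψ : OpenPartialHomeomorph Q (EuclideanSpace ℝ (Fin n))) (y v w : EuclideanSpace ℝ (Fin n)) :
    metricInChart g ψ y v w = g.inner (ψ.symm y) (mfderiv (𝓡 n) (𝓡 n) ψ.symm y v)
      (mfderiv (𝓡 n) (𝓡 n) ψ.symm y w) := rfl

/-- In finite dimension smoothness of a bilinear form can be tested on constant vectors, where it
becomes the metric applied to two smooth coordinate vector fields. -/
theorem contDiffOn_metricInChart (g : Metric n Q)
    {ψ : OpenPartialHomeomorph Q (EuclideanSpace ℝ (Fin n))}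
    (hψ : ψ ∈ IsManifold.maximalAtlas (𝓡 n) ∞ Q) :
    ContDiffOn ℝ ∞ (metricInChart g ψ) ψ.target := by
  rw [contDiffOn_clm_apply]
  intro v
  rw [contDiffOn_clm_apply]
  intro w
  rw [← contMDiffOn_iff_contDiffOn]
  intro y hy
  have h1 := (contMDiffOn_mfderiv_symm hψ v) y hy
  have h2 := (contMDiffOn_mfderiv_symm hψ w) y hy
  have h0 := g.contMDiff.comp_contMDiffOn (contMDiffOn_symm_of_mem_maximalAtlas hψ) y hy
  have := ContMDiffWithinAt.clm_bundle_apply₂ (F₁ := EuclideanSpace ℝ (Fin n))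
    (F₂ := EuclideanSpace ℝ (Fin n)) (F₃ := ℝ) (E₃ := Bundle.Trivial Q ℝ) h0 h1 h2
  rw [Bundle.contMDiffWithinAt_totalSpace] at this
  exact this.2

theorem metricInChart_isInvertible (g : Metric n Q)
    {ψ : OpenPartialHomeomorph Q (EuclideanSpace ℝ (Fin n))}
    (hψ : ψ ∈ IsManifold.maximalAtlas (𝓡 n) ∞ Q) {y : EuclideanSpace ℝ (Fin n)}
    (hy : y ∈ ψ.target) : (metricInChart g ψ y).IsInvertible := by
  have hinj : Function.Injective (metricInChart g ψ y) := by
    rw [injective_iff_map_eq_zero]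
    intro v hv
    have h1 : mfderiv (𝓡 n) (𝓡 n) ψ.symm y v = 0 := by
      by_contra hne
      have h2 := g.pos _ _ hne
      rw [← metricInChart_apply, hv] at h2
      exact lt_irrefl _ h2
    exact (map_eq_zero_iff _
      ((mdifferentiable_of_mem_maximalAtlas hψ).symm.mfderiv_injective hy)).1 h1
  let e := (metricInChart g ψ y).toLinearMap.linearEquivOfInjective hinj (by
    rw [← LinearMap.toContinuousLinearMap.finrank_eq]
    exact Subspace.dual_finrank_eq.symm)
  exact ⟨e.toContinuousLinearEquiv, ContinuousLinearMap.ext fun _ => rfl⟩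

end MetricInChart

section Coordinates

/-- Splitting off the first coordinate. -/
noncomputable def headTail (k : ℕ) :
    EuclideanSpace ℝ (Fin (k + 1)) ≃L[ℝ] ℝ × EuclideanSpace ℝ (Fin k) :=
  ((EuclideanSpace.equiv (Fin (k + 1)) ℝ).trans (Fin.consEquivL ℝ fun _ => ℝ).symm).trans
    ((ContinuousLinearEquiv.refl ℝ ℝ).prodCongr (EuclideanSpace.equiv (Fin k) ℝ).symm)

/-- The open box with the given corners. -/
def openBox {n : ℕ} (a b : Fin n → ℝ) : Set (EuclideanSpace ℝ (Fin n)) :=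
  {y | ∀ j, a j < y j ∧ y j < b j}

theorem isOpen_openBox {n : ℕ} (a b : Fin n → ℝ) : IsOpen (openBox a b) := by
  simp only [openBox, ofPred_forall]
  refine isOpen_iInter_of_finite fun j => ?_
  exact (isOpen_lt continuous_const (EuclideanSpace.proj (𝕜 := ℝ) j).continuous).inter
    (isOpen_lt (EuclideanSpace.proj (𝕜 := ℝ) j).continuous continuous_const)

theorem exists_openBox_subset {n : ℕ} {O : Set (EuclideanSpace ℝ (Fin n))} (hO : IsOpen O)
    {y : EuclideanSpace ℝ (Fin n)} (hy : y ∈ O) :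
    ∃ a b : Fin n → ℝ, y ∈ openBox a b ∧ openBox a b ⊆ O := by
  let e := EuclideanSpace.equiv (Fin n) ℝ
  have h1 : IsOpen (e.symm ⁻¹' O) := hO.preimage e.symm.continuous
  have h2 : e y ∈ e.symm ⁻¹' O := by simpa using hy
  obtain ⟨r, hr, hball⟩ := Metric.isOpen_iff.1 h1 _ h2
  refine ⟨fun j => y j - r, fun j => y j + r, fun j => ⟨by linarith, by linarith⟩, fun z hz => ?_⟩
  have h3 : e z ∈ Metric.ball (e y) r := by
    rw [ball_pi _ hr]
    intro j _
    change e z j ∈ Metric.ball (e y j) r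
    rw [Real.ball_eq_Ioo]
    exact hz j
  simpa using hball h3

end Coordinates

section GradientInChart

variable {n : ℕ}
  {Q : Type u} [TopologicalSpace Q] [ChartedSpace (EuclideanSpace ℝ (Fin n)) Q]

theorem contDiffOn_comp_symm {ψ : OpenPartialHomeomorph Q (EuclideanSpace ℝ (Fin n))}
    (hψ : ψ ∈ IsManifold.maximalAtlas (𝓡 n) ∞ Q) {f : Q → ℝ} {S : Set Q}
    (hf : ContMDiffOn (𝓡 n) 𝓘(ℝ, ℝ) ∞ f S) :
    ContDiffOn ℝ ∞ (f ∘ ψ.symm) (ψ.target ∩ ψ.symm ⁻¹' S) :=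
  contMDiffOn_iff_contDiffOn.1 <| hf.comp
    ((contMDiffOn_symm_of_mem_maximalAtlas hψ).mono inter_subset_left) fun _ hy => hy.2

theorem fderiv_comp_symm {ψ : OpenPartialHomeomorph Q (EuclideanSpace ℝ (Fin n))}
    (hψ : ψ ∈ IsManifold.maximalAtlas (𝓡 n) ∞ Q) {f : Q → ℝ} {y w : EuclideanSpace ℝ (Fin n)}
    (hy : y ∈ ψ.target) (hf : MDifferentiableAt (𝓡 n) 𝓘(ℝ, ℝ) f (ψ.symm y)) :
    fderiv ℝ (f ∘ ψ.symm) y w =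
      mfderiv (𝓡 n) 𝓘(ℝ, ℝ) f (ψ.symm y) (mfderiv (𝓡 n) (𝓡 n) ψ.symm y w) := by
  have h := mfderiv_comp y hf
    ((mdifferentiable_of_mem_maximalAtlas hψ).mdifferentiableAt_symm hy)
  rw [mfderiv_eq_fderiv] at h
  exact DFunLike.congr_fun h w

variable [IsManifold (𝓡 n) ∞ Q]

/-- The gradient of a smooth function is smooth, expressed in a chart. -/
theorem exists_gradient_in_chart (g : Metric n Q)
    {ψ : OpenPartialHomeomorph Q (EuclideanSpace ℝ (Fin n))}
    (hψ : ψ ∈ IsManifold.maximalAtlas (𝓡 n) ∞ Q) {f : Q → ℝ} {S : Set Q} (hS : IsOpen S)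
    (hf : ContMDiffOn (𝓡 n) 𝓘(ℝ, ℝ) ∞ f S) :
    ∃ X : EuclideanSpace ℝ (Fin n) → EuclideanSpace ℝ (Fin n),
      ContDiffOn ℝ ∞ X (ψ.target ∩ ψ.symm ⁻¹' S) ∧
      ∀ y ∈ ψ.target ∩ ψ.symm ⁻¹' S,
        mfderiv (𝓡 n) (𝓡 n) ψ.symm y (X y) = gradient g f (ψ.symm y) := by
  have hΩ : IsOpen (ψ.target ∩ ψ.symm ⁻¹' S) := ψ.isOpen_inter_preimage_symm hS
  have hfs := contDiffOn_comp_symm hψ hf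
  -- The coordinate formula for the gradient: the inverse of the metric matrix applied to the
  -- differential. It is smooth because operator inversion is.
  refine ⟨fun y => (metricInChart g ψ y).inverse (fderiv ℝ (f ∘ ψ.symm) y), ?_, ?_⟩
  · refine ContDiffOn.clm_apply (fun y hy => ?_) (hfs.fderiv_of_isOpen hΩ (m := ∞) le_rfl)
    obtain ⟨B, hB⟩ := metricInChart_isInvertible g hψ hy.1
    have h1 : ContDiffAt ℝ ∞ ContinuousLinearMap.inverse (metricInChart g ψ y) :=
      hB ▸ contDiffAt_map_inverse B
    exact h1.comp_contDiffWithinAt y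
      ((contDiffOn_metricInChart g hψ).mono inter_subset_left y hy)
  · intro y hy
    refine (lowerIndex_bijective g _).1 (LinearMap.ext fun v => ?_)
    obtain ⟨w, rfl⟩ := (mdifferentiable_of_mem_maximalAtlas hψ).symm.mfderiv_surjective hy.1 v
    rw [lowerIndex_apply, lowerIndex_apply, inner_gradient]
    have h1 := (metricInChart_isInvertible g hψ hy.1).self_apply_inverse
      (fderiv ℝ (f ∘ ψ.symm) y)
    have h2 := fderiv_comp_symm hψ (w := w) hy.1
      ((hf.contMDiffAt (hS.mem_nhds hy.2)).mdifferentiableAt (by simp))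
    refine Eq.trans ?_ h2
    exact DFunLike.congr_fun h1 w

end GradientInChart

/-! ### Flat charts for the gradient line field -/

section FlatChart

variable {k : ℕ}
  {Q : Type u} [TopologicalSpace Q] [ChartedSpace (EuclideanSpace ℝ (Fin (k + 1))) Q]
  [IsManifold (𝓡 (k + 1)) ∞ Q]
  {M : Type v} [TopologicalSpace M] [ChartedSpace (EuclideanSpace ℝ (Fin 1)) M]
  [IsManifold (𝓡 1) ∞ M]

/-- The coordinate function together with first integrals of a transverse vector field form a
local coordinate system. -/
theorem exists_adapted_coordinates
    {X : EuclideanSpace ℝ (Fin (k + 1)) → EuclideanSpace ℝ (Fin (k + 1))}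
    {f : EuclideanSpace ℝ (Fin (k + 1)) → ℝ} {Ω : Set (EuclideanSpace ℝ (Fin (k + 1)))}
    (hΩ : IsOpen Ω) (hX : ContDiffOn ℝ ∞ X Ω) (hf : ContDiffOn ℝ ∞ f Ω)
    {y₀ : EuclideanSpace ℝ (Fin (k + 1))} (hy : y₀ ∈ Ω) (hfX : ∀ y ∈ Ω, fderiv ℝ f y (X y) ≠ 0) :
    ∃ e : OpenPartialHomeomorph (EuclideanSpace ℝ (Fin (k + 1))) (EuclideanSpace ℝ (Fin (k + 1))),
      y₀ ∈ e.source ∧ e.source ⊆ Ω ∧ ContDiffOn ℝ ∞ e e.source ∧ ContDiffOn ℝ ∞ e.symm e.target ∧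
      ∀ y ∈ e.source, ∀ w, (headTail k (fderiv ℝ e y w)).2 = 0 ↔ w ∈ Submodule.span ℝ {X y} := by
  let E := EuclideanSpace ℝ (Fin (k + 1))
  let ℓ : E →L[ℝ] ℝ := fderiv ℝ f y₀
  set c := ℓ (X y₀) with hc
  have hc0 : c ≠ 0 := hfX y₀ hy
  -- The first integral theorem needs the normalization `ℓ (X y₀) = 1`; scaling by a constant
  -- changes neither the line field nor its first integrals.
  have hX1 : ContDiffOn ℝ ∞ (fun y => c⁻¹ • X y) Ω :=
    (contDiffOn_const (c := c⁻¹)).smul hX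
  obtain ⟨U, ξ, hU, hyU, hUΩ, hξ, hξX, hξ0⟩ := exists_first_integral hΩ hX1 hy ℓ (by
    rw [map_smul, ← hc, smul_eq_mul, inv_mul_cancel₀ hc0])
  have hrank : Module.finrank ℝ ℓ.ker = Module.finrank ℝ (EuclideanSpace ℝ (Fin k)) := by
    have h1 := ℓ.toLinearMap.finrank_range_add_finrank_ker
    have h2 : ℓ.toLinearMap.range = ⊤ := LinearMap.range_eq_top.2
      (LinearMap.surjective (f := ℓ.toLinearMap) fun h => hc0 (by
        rw [hc]
        exact DFunLike.congr_fun h (X y₀)))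
    rw [h2, finrank_top, Module.finrank_self, finrank_euclideanSpace_fin] at h1
    rw [finrank_euclideanSpace_fin]
    omega
  let L : ℓ.ker ≃L[ℝ] EuclideanSpace ℝ (Fin k) := ContinuousLinearEquiv.ofFinrankEq hrank
  let θ : E → E := fun y => (headTail k).symm (f y, L (ξ y))
  have hθ : ContDiffOn ℝ ∞ θ U := (headTail k).symm.contDiff.comp_contDiffOn
    ((hf.mono hUΩ).prodMk (L.contDiff.comp_contDiffOn hξ))
  have hθd : ∀ y ∈ U, ∀ w,
      headTail k (fderiv ℝ θ y w) = (fderiv ℝ f y w, L (fderiv ℝ ξ y w)) := by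
    intro y hy w
    have h1 : HasFDerivAt f (fderiv ℝ f y) y :=
      ((hf.contDiffAt (hΩ.mem_nhds (hUΩ hy))).differentiableAt (by simp)).hasFDerivAt
    have h2 : HasFDerivAt ξ (fderiv ℝ ξ y) y :=
      ((hξ.contDiffAt (hU.mem_nhds hy)).differentiableAt (by simp)).hasFDerivAt
    have h3 : HasFDerivAt θ ((headTail k).symm.toContinuousLinearMap.comp
        ((fderiv ℝ f y).prod (L.toContinuousLinearMap.comp (fderiv ℝ ξ y)))) y :=
      (headTail k).symm.toContinuousLinearMap.hasFDerivAt.comp y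
        (h1.prodMk (L.toContinuousLinearMap.hasFDerivAt.comp y h2))
    rw [h3.fderiv]
    exact (headTail k).apply_symm_apply _
  have hinv : (fderiv ℝ θ y₀).IsInvertible := by
    have hinj : Function.Injective (fderiv ℝ θ y₀).toLinearMap := by
      rw [injective_iff_map_eq_zero]
      intro w hw
      have h1 := hθd y₀ hyU w
      rw [show fderiv ℝ θ y₀ w = 0 from hw, map_zero, eq_comm, Prod.mk_eq_zero] at h1
      exact hξ0 w ((map_eq_zero_iff _ L.injective).1 h1.2) h1.1
    exact ⟨((fderiv ℝ θ y₀).toLinearMap.linearEquivOfInjective hinj rfl).toContinuousLinearEquiv,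
      ContinuousLinearMap.ext fun _ => rfl⟩
  obtain ⟨e, hye, heU, heθ, hein, hes⟩ := exists_openPartialHomeomorph_of_contDiffOn hU hθ hyU hinv
  refine ⟨e, hye, heU.trans hUΩ, ?_, hes, fun y hy w => ?_⟩
  · rw [heθ]
    exact hθ.mono heU
  have hXy : fderiv ℝ ξ y (X y) = 0 := by
    have h1 := hξX y (heU hy)
    rw [map_smul] at h1
    exact (smul_eq_zero.1 h1).resolve_left (inv_ne_zero hc0)
  have hd : fderiv ℝ f y (X y) ≠ 0 := hfX y (hUΩ (heU hy))
  rw [heθ, hθd y (heU hy), map_eq_zero_iff _ L.injective]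
  refine ⟨fun h => ?_, fun h => ?_⟩
  -- With this `t`, the vector `w - t • X y` is killed by both `df` and `dξ`, hence by the
  -- invertible `dθ`.
  · set t := fderiv ℝ f y w / fderiv ℝ f y (X y)
    have h1 : fderiv ℝ θ y (w - t • X y) = 0 := by
      refine (headTail k).injective ?_
      rw [hθd y (heU hy), map_zero, map_sub, map_sub, map_smul, map_smul, hXy, h, smul_eq_mul,
        div_mul_cancel₀ _ hd]
      simp
    have h2 : w - t • X y = 0 := (map_eq_zero_iff _ (hein y hy).injective).1 h1
    rw [sub_eq_zero.1 h2]
    exact Submodule.smul_mem _ _ (Submodule.mem_span_singleton_self _)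
  · obtain ⟨t, rfl⟩ := Submodule.mem_span_singleton.1 h
    rw [map_smul, hXy, smul_zero]

/-- Around every point there is a flat chart for the gradient distribution. -/
theorem exists_flat_chart (g : Metric (k + 1) Q) {H : Q → M}
    (hH : ContMDiff (𝓡 (k + 1)) (𝓡 1) ∞ H)
    (hsub : ∀ q, Function.Surjective (mfderiv (𝓡 (k + 1)) (𝓡 1) H q)) (q : Q) :
    ∃ φ ∈ IsManifold.maximalAtlas (𝓡 (k + 1)) ∞ Q, q ∈ φ.source ∧
      (∃ a b, φ.target = openBox a b) ∧
      ∀ p ∈ φ.source, ∀ v : TangentSpace (𝓡 (k + 1)) p,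
        v ∈ gradientDistribution (m := 1) g H p ↔
          (headTail k (mfderiv (𝓡 (k + 1)) (𝓡 (k + 1)) φ p v)).2 = 0 := by
  let ψ := chartAt (EuclideanSpace ℝ (Fin (k + 1))) q
  let x := chartAt (EuclideanSpace ℝ (Fin 1)) (H q)
  have hψ : ψ ∈ IsManifold.maximalAtlas (𝓡 (k + 1)) ∞ Q := IsManifold.chart_mem_maximalAtlas q
  have hx : x ∈ IsManifold.maximalAtlas (𝓡 1) ∞ M := IsManifold.chart_mem_maximalAtlas (H q)
  have hψd := mdifferentiable_of_mem_maximalAtlas hψ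
  let h := taskCoord (m := 1) H x 0
  let S := H ⁻¹' x.source
  have hS : IsOpen S := x.open_source.preimage hH.continuous
  have hh : ContMDiffOn (𝓡 (k + 1)) 𝓘(ℝ, ℝ) ∞ h S := contMDiffOn_taskCoord hH hx
  let Ω := ψ.target ∩ ψ.symm ⁻¹' S
  have hΩ : IsOpen Ω := ψ.isOpen_inter_preimage_symm hS
  obtain ⟨X, hX, hXg⟩ := exists_gradient_in_chart g hψ hS hh
  have hqψ : q ∈ ψ.source := mem_chart_source _ q
  have hψq : ψ q ∈ Ω := ⟨ψ.map_source hqψ, by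
    change ψ.symm (ψ q) ∈ S
    rw [ψ.left_inv hqψ]
    exact mem_chart_source (EuclideanSpace ℝ (Fin 1)) (H q)⟩
  obtain ⟨e, hqe, heΩ, hes, het, heX⟩ := exists_adapted_coordinates hΩ hX
    (contDiffOn_comp_symm hψ hh) hψq (fun y hy => by
      rw [fderiv_comp_symm hψ hy.1
        ((hh.contMDiffAt (hS.mem_nhds hy.2)).mdifferentiableAt (by simp)), hXg y hy]
      exact (mfderiv_taskCoord_gradient_pos g hH hx hy.2 (hsub _)).ne')
  let φ₀ := ψ.trans e
  have hqφ₀ : q ∈ φ₀.source := by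
    rw [ψ.trans_source]
    exact ⟨hqψ, hqe⟩
  -- The image is shrunk to a box, as a flat chart requires; since boxes are convex, the plaques
  -- will be connected.
  obtain ⟨a, b, hqbox, hbox⟩ := exists_openBox_subset φ₀.open_target (φ₀.map_source hqφ₀)
  let φ := (φ₀.symm.restrOpen (openBox a b) (isOpen_openBox a b)).symm
  have hφt : φ.target = openBox a b := by
    change φ₀.target ∩ openBox a b = _
    exact inter_eq_right.2 hbox
  have hφs : φ.source ⊆ φ₀.source := by
    intro p hp
    have h1 := φ.map_source hp
    rw [hφt] at h1
    have h2 := φ₀.map_target (hbox h1)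
    have h3 : φ₀.symm (φ p) = p := φ.left_inv hp
    rwa [h3] at h2
  have hφψ : φ.source ⊆ ψ.source := fun p hp => by
    have := hφs hp
    rw [ψ.trans_source] at this
    exact this.1
  have hφe : ∀ p ∈ φ.source, ψ p ∈ e.source := fun p hp => by
    have := hφs hp
    rw [ψ.trans_source] at this
    exact this.2
  have hφt₀ : ∀ y ∈ φ.target, y ∈ e.target ∧ e.symm y ∈ ψ.target := fun y hy => by
    rw [hφt] at hy
    have := hbox hy
    rw [ψ.trans_target] at this
    exact this
  refine ⟨φ, ?_, ?_, ⟨a, b, hφt⟩, fun p hp v => ?_⟩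
  · refine φ.mem_maximalAtlas_of_contMDiffOn ?_ ?_
    · exact (contMDiffOn_iff_contDiffOn.2 hes).comp
        ((contMDiffOn_of_mem_maximalAtlas hψ).mono hφψ) hφe
    · exact (contMDiffOn_symm_of_mem_maximalAtlas hψ).comp
        ((contMDiffOn_iff_contDiffOn.2 het).mono fun y hy => (hφt₀ y hy).1) fun y hy => (hφt₀ y hy).2
  · have h1 : φ.symm (φ₀ q) ∈ φ.source := φ.map_target (by rw [hφt]; exact hqbox)
    have h2 : φ.symm (φ₀ q) = q := φ₀.left_inv hqφ₀
    rwa [h2] at h1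
  · have hpψ := hφψ hp
    have hpe := hφe p hp
    have hψp : ψ.symm (ψ p) = p := ψ.left_inv hpψ
    have hpS : p ∈ S := by
      have := (heΩ hpe).2
      rwa [mem_preimage, hψp] at this
    have h1 : HasMFDerivAt (𝓡 (k + 1)) (𝓡 (k + 1)) φ p
        ((fderiv ℝ e (ψ p)).comp (mfderiv (𝓡 (k + 1)) (𝓡 (k + 1)) ψ p)) := by
      have he : HasMFDerivAt (𝓡 (k + 1)) (𝓡 (k + 1)) e (ψ p) (fderiv ℝ e (ψ p)) :=
        ((hes.contDiffAt (e.open_source.mem_nhds hpe)).differentiableAt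
          (by simp)).hasFDerivAt.hasMFDerivAt
      exact he.comp p (hψd.mdifferentiableAt hpψ).hasMFDerivAt
    have h2 : mfderiv (𝓡 (k + 1)) (𝓡 (k + 1)) ψ p (gradient g h p) = X (ψ p) := by
      have h3 := hXg (ψ p) (heΩ hpe)
      have h4 := DFunLike.congr_fun (hψd.comp_symm_deriv (heΩ hpe).1) (X (ψ p))
      change mfderiv (𝓡 (k + 1)) (𝓡 (k + 1)) ψ (ψ.symm (ψ p))
        (mfderiv (𝓡 (k + 1)) (𝓡 (k + 1)) ψ.symm (ψ p) (X (ψ p))) = X (ψ p) at h4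
      rw [h3, hψp] at h4
      exact h4
    rw [gradientDistribution_eq_orthogonalComplement g hH (hsub p),
      ← span_gradient_taskCoord g hH hx hpS (hsub p), h1.mfderiv]
    refine Iff.trans ?_ (heX (ψ p) hpe _).symm
    rw [Submodule.mem_span_singleton, Submodule.mem_span_singleton, ← h2]
    refine exists_congr fun t => ?_
    refine Iff.trans (hψd.mfderiv_injective hpψ).eq_iff.symm ?_
    rw [map_smul]
    rfl

end FlatChart

/-! ### Second countability of connected components -/

section SecondCountable

variable {X : Type*} [TopologicalSpace X]

/-- If a space has a cover by second countable open sets each of which meets only countably many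
of the others, then its connected components are second countable. -/
theorem secondCountableTopology_connectedComponent {ι : Type*} {O : ι → Set X}
    (hO : ∀ i, IsOpen (O i)) (hcov : ⋃ i, O i = univ)
    (hsc : ∀ i, SecondCountableTopology (O i))
    (hcount : ∀ i, {j | (O i ∩ O j).Nonempty}.Countable) (x : X) :
    SecondCountableTopology (connectedComponent x) := by
  obtain ⟨i₀, hi₀⟩ := mem_iUnion.1 (hcov ▸ mem_univ x : x ∈ ⋃ i, O i)
  -- `T n` is the set of indices reached from `i₀` by chains of `n` consecutively meeting sets. Each
  -- `T n` is countable, and the union of all sets reached is clopen, so it contains the component.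
  let T : ℕ → Set ι := fun n => Nat.rec {i₀} (fun _ S => ⋃ i ∈ S, {j | (O i ∩ O j).Nonempty}) n
  have hT : ∀ n, (T n).Countable := by
    intro n
    induction n with
    | zero => exact countable_singleton i₀
    | succ n ih => exact ih.biUnion fun i _ => hcount i
  let J : Set ι := ⋃ n, T n
  have hJ : J.Countable := countable_iUnion hT
  have hstep : ∀ i ∈ J, ∀ j, (O i ∩ O j).Nonempty → j ∈ J := by
    intro i hi j hj
    obtain ⟨n, hn⟩ := mem_iUnion.1 hi
    exact mem_iUnion.2 ⟨n + 1, mem_iUnion₂.2 ⟨i, hn, hj⟩⟩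
  have hclopen : IsClopen (⋃ i ∈ J, O i) := by
    refine ⟨⟨isOpen_iff_mem_nhds.2 fun y hy => ?_⟩, isOpen_biUnion fun i _ => hO i⟩
    obtain ⟨j, hj⟩ := mem_iUnion.1 (hcov ▸ mem_univ y : y ∈ ⋃ i, O i)
    refine mem_of_superset ((hO j).mem_nhds hj) fun z hz hzV => hy ?_
    obtain ⟨i, hi, hzi⟩ := mem_iUnion₂.1 hzV
    exact mem_iUnion₂.2 ⟨j, hstep i hi j ⟨z, hzi, hz⟩, hj⟩
  have hsub : connectedComponent x ⊆ ⋃ i ∈ J, O i :=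
    hclopen.connectedComponent_subset
      (mem_iUnion₂.2 ⟨i₀, mem_iUnion.2 ⟨0, mem_singleton i₀⟩, hi₀⟩)
  have : Countable J := hJ.to_subtype
  let U : J → Set (connectedComponent x) := fun i => Subtype.val ⁻¹' O i
  have hU : ∀ i, SecondCountableTopology (U i) := fun i => by
    have := hsc i
    let F : U i → O i := fun z => ⟨z.1.1, z.2⟩
    have hF : IsInducing F := by
      refine IsInducing.of_comp (g := Subtype.val) (by fun_prop) continuous_subtype_val ?_
      exact show IsInducing fun z : U i => (z.1.1 : X) from
        IsInducing.subtypeVal.comp IsInducing.subtypeVal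
    exact hF.secondCountableTopology
  refine TopologicalSpace.secondCountableTopology_of_countable_cover (U := U)
    (fun i => (hO i).preimage continuous_subtype_val) ?_
  refine eq_univ_of_forall fun z => ?_
  obtain ⟨i, hi, hzi⟩ := mem_iUnion₂.1 (hsub z.2)
  exact mem_iUnion.2 ⟨⟨i, hi⟩, hzi⟩

end SecondCountable

/-! ### Flat atlases and compatibility of plaques -/

section FlatAtlas

variable {k : ℕ} {Q : Type u} [TopologicalSpace Q]
  [ChartedSpace (EuclideanSpace ℝ (Fin (k + 1))) Q]

/-- A family of charts, one around each point, with open boxes as images, in which the line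
field `D` points in the direction of the first coordinate. -/
structure FlatAtlas (D : ∀ q : Q, Submodule ℝ (TangentSpace (𝓡 (k + 1)) q)) where
  chart : Q → OpenPartialHomeomorph Q (EuclideanSpace ℝ (Fin (k + 1)))
  mem_maximalAtlas : ∀ q, chart q ∈ IsManifold.maximalAtlas (𝓡 (k + 1)) ∞ Q
  mem_source : ∀ q, q ∈ (chart q).source
  target_eq : ∀ q, ∃ a b, (chart q).target = openBox a b
  mem_iff : ∀ q, ∀ p ∈ (chart q).source, ∀ v : TangentSpace (𝓡 (k + 1)) p,
    v ∈ D p ↔ (headTail k (mfderiv (𝓡 (k + 1)) (𝓡 (k + 1)) (chart q) p v)).2 = 0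

variable {D : ∀ q : Q, Submodule ℝ (TangentSpace (𝓡 (k + 1)) q)} (A : FlatAtlas D)

namespace FlatAtlas

/-- The transverse coordinates in the chart around `a`. -/
noncomputable def tail (a p : Q) : EuclideanSpace ℝ (Fin k) := (headTail k (A.chart a p)).2

/-- The coordinate along the line field in the chart around `a`. -/
noncomputable def height (a p : Q) : ℝ := (headTail k (A.chart a p)).1

theorem headTail_symm_height_tail (a p : Q) :
    (headTail k).symm (A.height a p, A.tail a p) = A.chart a p :=
  (headTail k).symm_apply_apply _

end FlatAtlas

theorem convex_openBox {n : ℕ} (a b : Fin n → ℝ) : Convex ℝ (openBox a b) := by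
  intro y hy z hz s t hs ht hst j
  have h1 : (s • y + t • z) j = s * y j + t * z j := rfl
  rw [h1]
  exact ⟨(convex_Ioo (a j) (b j) (hy j) (hz j) hs ht hst).1,
    (convex_Ioo (a j) (b j) (hy j) (hz j) hs ht hst).2⟩

/-- A map whose differential preserves the direction of the first coordinate preserves the lines
in that direction. -/
theorem headTail_snd_eq_of_fderiv {τ : EuclideanSpace ℝ (Fin (k + 1)) →
    EuclideanSpace ℝ (Fin (k + 1))} {B : Set (EuclideanSpace ℝ (Fin (k + 1)))}
    (hB : Convex ℝ B) (hτ : ∀ y ∈ B, DifferentiableAt ℝ τ y)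
    (hd : ∀ y ∈ B, ∀ w, (headTail k w).2 = 0 → (headTail k (fderiv ℝ τ y w)).2 = 0)
    {y z : EuclideanSpace ℝ (Fin (k + 1))} (hy : y ∈ B) (hz : z ∈ B)
    (h : (headTail k z).2 = (headTail k y).2) : (headTail k (τ z)).2 = (headTail k (τ y)).2 := by
  -- The segment from `y` to `z` stays in the convex set and points along the first axis, so the
  -- transverse part of `τ` has zero derivative on it.
  let γ : ℝ → EuclideanSpace ℝ (Fin (k + 1)) := fun t => y + t • (z - y)
  have hγB : ∀ t ∈ Icc (0 : ℝ) 1, γ t ∈ B := fun t ht => hB.add_smul_sub_mem hy hz ht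
  let π : EuclideanSpace ℝ (Fin (k + 1)) →L[ℝ] EuclideanSpace ℝ (Fin k) :=
    (ContinuousLinearMap.snd ℝ ℝ _).comp (headTail k).toContinuousLinearMap
  have hγ : ∀ t, HasDerivAt γ (z - y) t := fun t => by
    have := ((hasDerivAt_id t).smul_const (z - y)).const_add y
    rwa [one_smul] at this
  have hder : ∀ t ∈ Icc (0 : ℝ) 1, HasDerivAt (fun t => π (τ (γ t))) 0 t := by
    intro t ht
    have h1 := (π.hasFDerivAt.comp _ (hτ _ (hγB t ht)).hasFDerivAt).comp_hasDerivAt t (hγ t)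
    have h2 : π (fderiv ℝ τ (γ t) (z - y)) = 0 := hd _ (hγB t ht) _ (by
      rw [map_sub, Prod.snd_sub, h, sub_self])
    rw [ContinuousLinearMap.comp_apply, h2] at h1
    exact h1
  have hconst := constant_of_has_deriv_right_zero
    (fun t ht => (hder t ht).continuousAt.continuousWithinAt)
    (fun t ht => (hder t ⟨ht.1, ht.2.le⟩).hasDerivWithinAt) 1 ⟨zero_le_one, le_rfl⟩
  have h0 : γ 0 = y := by simp [γ]
  have h1 : γ 1 = z := by simp [γ]
  rw [h0, h1] at hconst
  exact hconst

namespace FlatAtlas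

/-- Two flat charts have the same germs of plaques. -/
theorem eventually_tail_eq {a b p : Q} (ha : p ∈ (A.chart a).source)
    (hb : p ∈ (A.chart b).source) :
    ∀ᶠ p' in 𝓝 p, A.tail a p' = A.tail a p → A.tail b p' = A.tail b p := by
  set φ := A.chart a
  set χ := A.chart b
  have hφ := mdifferentiable_of_mem_maximalAtlas (A.mem_maximalAtlas a)
  have hχ := mdifferentiable_of_mem_maximalAtlas (A.mem_maximalAtlas b)
  have hN : IsOpen (φ.target ∩ φ.symm ⁻¹' χ.source) := φ.isOpen_inter_preimage_symm χ.open_source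
  have hpN : φ p ∈ φ.target ∩ φ.symm ⁻¹' χ.source :=
    ⟨φ.map_source ha, by rwa [mem_preimage, φ.left_inv ha]⟩
  obtain ⟨l, r, hbox, hsub⟩ := exists_openBox_subset hN hpN
  let T : EuclideanSpace ℝ (Fin (k + 1)) →
      EuclideanSpace ℝ (Fin (k + 1)) →L[ℝ] EuclideanSpace ℝ (Fin (k + 1)) := fun y =>
    (mfderiv (𝓡 (k + 1)) (𝓡 (k + 1)) χ (φ.symm y)).comp
      (mfderiv (𝓡 (k + 1)) (𝓡 (k + 1)) φ.symm y)
  have hd : ∀ y ∈ openBox l r, HasFDerivAt (χ ∘ φ.symm) (T y) y := fun y hy =>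
    (HasMFDerivAt.comp y (hχ.mdifferentiableAt (hsub hy).2).hasMFDerivAt
      (hφ.mdifferentiableAt_symm (hsub hy).1).hasMFDerivAt).hasFDerivAt
  have hdir : ∀ y ∈ openBox l r, ∀ w, (headTail k w).2 = 0 →
      (headTail k (fderiv ℝ (χ ∘ φ.symm) y w)).2 = 0 := by
    intro y hy w hw
    rw [(hd y hy).fderiv]
    refine (A.mem_iff b _ (hsub hy).2 _).1
      ((A.mem_iff a _ (φ.map_target (hsub hy).1) _).2 ?_)
    have h1 : mfderiv (𝓡 (k + 1)) (𝓡 (k + 1)) φ (φ.symm y)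
        (mfderiv (𝓡 (k + 1)) (𝓡 (k + 1)) φ.symm y w) = w :=
      DFunLike.congr_fun (hφ.comp_symm_deriv (hsub hy).1) w
    change (headTail k (mfderiv (𝓡 (k + 1)) (𝓡 (k + 1)) φ (φ.symm y)
        (mfderiv (𝓡 (k + 1)) (𝓡 (k + 1)) φ.symm y w))).2 = 0
    rw [h1]
    exact hw
  filter_upwards [φ.open_source.mem_nhds ha,
    (φ.continuousAt ha).preimage_mem_nhds ((isOpen_openBox l r).mem_nhds hbox)] with p' hs hp' ht
  have := headTail_snd_eq_of_fderiv (convex_openBox l r)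
    (fun y hy => (hd y hy).differentiableAt) hdir hbox hp' ht
  rwa [Function.comp_apply, Function.comp_apply, φ.left_inv hs, φ.left_inv ha] at this

end FlatAtlas

end FlatAtlas

/-! ### The leaf topology and its one-dimensional manifold structure -/

section LeafSpace

variable {k : ℕ} {Q : Type u} [TopologicalSpace Q]
  [ChartedSpace (EuclideanSpace ℝ (Fin (k + 1))) Q]
  {D : ∀ q : Q, Submodule ℝ (TangentSpace (𝓡 (k + 1)) q)}

/-- The manifold `Q` with the leaf topology. -/
def LeafSpace (_ : FlatAtlas D) : Type u := Q

namespace FlatAtlas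

variable (A : FlatAtlas D)

/-- The neighbourhoods of a point in its plaque. -/
def leafNhds (p : Q) : Filter Q := 𝓝 p ⊓ 𝓟 {p' | A.tail p p' = A.tail p p}

/-- `eventually_tail_eq` used in both directions: any flat chart around `p` cuts out the same germ
of plaque. -/
theorem leafNhds_eq {a p : Q} (ha : p ∈ (A.chart a).source) :
    A.leafNhds p = 𝓝 p ⊓ 𝓟 {p' | A.tail a p' = A.tail a p} :=
  le_antisymm
    (le_inf inf_le_left (le_principal_iff.2
      (mem_inf_principal.2 (A.eventually_tail_eq (A.mem_source p) ha))))
    (le_inf inf_le_left (le_principal_iff.2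
      (mem_inf_principal.2 (A.eventually_tail_eq ha (A.mem_source p)))))

instance : TopologicalSpace (LeafSpace A) := TopologicalSpace.mkOfNhds A.leafNhds

/-- `mkOfNhds` realizes the prescribed filters only if a neighbourhood of `q` is one of all nearby
points of its plaque. This holds because `leafNhds_eq` allows the filters of those points to be
computed in the chart of `q`. -/
theorem nhds_leafSpace_eq_leafNhds (p : Q) :
    @nhds (LeafSpace A) _ p = A.leafNhds p := by
  refine TopologicalSpace.nhds_mkOfNhds A.leafNhds p (fun q => ?_) fun q s hs => ?_
  · exact le_inf (pure_le_nhds q) (le_principal_iff.2 rfl)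
  · rw [leafNhds, mem_inf_principal] at hs
    rw [leafNhds, eventually_inf_principal]
    filter_upwards [eventually_eventually_nhds.2 hs,
      (A.chart q).open_source.mem_nhds (A.mem_source q)] with y hy hys hyt
    rw [A.leafNhds_eq hys, mem_inf_principal]
    filter_upwards [hy] with z hz hzt
    exact hz (hzt.trans hyt)

theorem nhds_leafSpace {a p : Q} (ha : p ∈ (A.chart a).source) :
    @nhds (LeafSpace A) _ p = 𝓝 p ⊓ 𝓟 {p' | A.tail a p' = A.tail a p} :=
  (A.nhds_leafSpace_eq_leafNhds p).trans (A.leafNhds_eq ha)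

/-- The identity map from the leaf space to the manifold. -/
def toBase (p : LeafSpace A) : Q := p

theorem injective_toBase : Function.Injective A.toBase := fun _ _ h => h

theorem continuous_toBase : Continuous A.toBase := by
  refine continuous_iff_continuousAt.2 fun p => ?_
  rw [ContinuousAt, A.nhds_leafSpace (A.mem_source p)]
  exact tendsto_id.mono_left inf_le_left

instance [T2Space Q] : T2Space (LeafSpace A) :=
  T2Space.of_injective_continuous A.injective_toBase A.continuous_toBase

/-- The plaque with transverse coordinates `c` in the chart around `a`. -/
def plaque (a : Q) (c : EuclideanSpace ℝ (Fin k)) : Set (LeafSpace A) :=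
  {p | A.toBase p ∈ (A.chart a).source ∧ A.tail a (A.toBase p) = c}

theorem isOpen_plaque (a : Q) (c : EuclideanSpace ℝ (Fin k)) : IsOpen (A.plaque a c) := by
  refine isOpen_iff_mem_nhds.2 fun p hp => ?_
  refine (A.nhds_leafSpace hp.1).le (mem_inf_principal.2 ?_)
  filter_upwards [(A.chart a).open_source.mem_nhds hp.1] with p' hs ht
  exact ⟨hs, ht.trans hp.2⟩

/-- The one-dimensional Euclidean space is the real line. -/
noncomputable def line : EuclideanSpace ℝ (Fin 1) ≃L[ℝ] ℝ :=
  (EuclideanSpace.equiv (Fin 1) ℝ).trans (ContinuousLinearEquiv.funUnique (Fin 1) ℝ ℝ)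

/-- The parametrization of the line with transverse coordinates `c`. -/
noncomputable def sliceMap (c : EuclideanSpace ℝ (Fin k)) (y : EuclideanSpace ℝ (Fin 1)) :
    EuclideanSpace ℝ (Fin (k + 1)) :=
  (headTail k).symm (line y, c)

theorem headTail_sliceMap (c : EuclideanSpace ℝ (Fin k)) (y : EuclideanSpace ℝ (Fin 1)) :
    headTail k (sliceMap c y) = (line y, c) :=
  (headTail k).apply_symm_apply _

theorem contDiff_sliceMap (c : EuclideanSpace ℝ (Fin k)) : ContDiff ℝ ∞ (sliceMap c) :=
  (headTail k).symm.contDiff.comp (line.contDiff.prodMk contDiff_const)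

theorem sliceMap_line_symm_height (a p : Q) :
    sliceMap (A.tail a p) (line.symm (A.height a p)) = A.chart a p := by
  rw [sliceMap, line.apply_symm_apply]
  exact A.headTail_symm_height_tail a p

/-- A plaque is parametrized by the coordinate along the line field. -/
noncomputable def leafChart (a : Q) (c : EuclideanSpace ℝ (Fin k)) :
    OpenPartialHomeomorph (LeafSpace A) (EuclideanSpace ℝ (Fin 1)) where
  toFun p := line.symm (A.height a (A.toBase p))
  invFun y := (A.chart a).symm (sliceMap c y)
  source := A.plaque a c
  target := sliceMap c ⁻¹' (A.chart a).target
  map_source' := by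
    rintro p ⟨hp, rfl⟩
    rw [mem_preimage, sliceMap_line_symm_height]
    exact (A.chart a).map_source hp
  map_target' := by
    intro y hy
    refine ⟨(A.chart a).map_target hy, ?_⟩
    change (headTail k (A.chart a ((A.chart a).symm _))).2 = c
    rw [(A.chart a).right_inv hy, headTail_sliceMap]
  left_inv' := by
    rintro p ⟨hp, rfl⟩
    rw [sliceMap_line_symm_height]
    exact (A.chart a).left_inv hp
  right_inv' := by
    intro y hy
    change line.symm (headTail k (A.chart a ((A.chart a).symm _))).1 = y
    rw [(A.chart a).right_inv hy, headTail_sliceMap]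
    exact line.symm_apply_apply y
  open_source := A.isOpen_plaque a c
  open_target := (A.chart a).open_target.preimage (contDiff_sliceMap c).continuous
  continuousOn_toFun := by
    have h1 : ContinuousOn (A.chart a ∘ A.toBase) (A.plaque a c) :=
      (A.chart a).continuousOn.comp A.continuous_toBase.continuousOn fun _ hp => hp.1
    exact line.symm.continuous.comp_continuousOn
      (continuous_fst.comp_continuousOn ((headTail k).continuous.comp_continuousOn h1))
  continuousOn_invFun := by
    intro y hy
    refine ContinuousAt.continuousWithinAt ?_
    have hs := (A.chart a).map_target hy
    have hev : ∀ᶠ z in 𝓝 y, sliceMap c z ∈ (A.chart a).target :=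
      (contDiff_sliceMap c).continuous.continuousAt.preimage_mem_nhds
        ((A.chart a).open_target.mem_nhds hy)
    have htail : ∀ z, sliceMap c z ∈ (A.chart a).target →
        A.tail a ((A.chart a).symm (sliceMap c z)) = c := fun z hz => by
      change (headTail k (A.chart a ((A.chart a).symm _))).2 = c
      rw [(A.chart a).right_inv hz, headTail_sliceMap]
    -- Convergence in the leaf topology is convergence in `Q` together with eventually constant
    -- transverse coordinates.
    have h : Tendsto (fun z => (A.chart a).symm (sliceMap c z)) (𝓝 y)
        (@nhds (LeafSpace A) _ ((A.chart a).symm (sliceMap c y))) := by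
      rw [A.nhds_leafSpace hs]
      refine tendsto_inf.2 ⟨?_, tendsto_principal.2 ?_⟩
      · exact ((A.chart a).continuousAt_symm hy).tendsto.comp
          (contDiff_sliceMap c).continuous.continuousAt
      · filter_upwards [hev] with z hz
        exact (htail z hz).trans (htail y hy).symm
    exact h

theorem mem_leafChart_source (p : Q) : p ∈ (A.leafChart p (A.tail p p)).source :=
  ⟨A.mem_source p, rfl⟩

noncomputable instance : ChartedSpace (EuclideanSpace ℝ (Fin 1)) (LeafSpace A) where
  atlas := {e | ∃ a c, e = A.leafChart a c}
  chartAt p := A.leafChart p (A.tail p p)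
  mem_chart_source p := A.mem_leafChart_source p
  chart_mem_atlas _ := ⟨_, _, rfl⟩

/-- A transition map of leaf charts is the inclusion of a slice, a smooth transition map of `Q`, and
the projection to the first coordinate. -/
instance : IsManifold (𝓡 1) ∞ (LeafSpace A) := by
  refine isManifold_of_contDiffOn _ _ _ ?_
  rintro _ _ ⟨a, c, rfl⟩ ⟨b, d, rfl⟩
  have h1 : ContDiffOn ℝ ∞ (A.chart b ∘ (A.chart a).symm)
      ((A.chart a).target ∩ (A.chart a).symm ⁻¹' (A.chart b).source) :=
    contMDiffOn_iff_contDiffOn.1 <| (contMDiffOn_of_mem_maximalAtlas (A.mem_maximalAtlas b)).comp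
      ((contMDiffOn_symm_of_mem_maximalAtlas (A.mem_maximalAtlas a)).mono inter_subset_left)
      fun _ hy => hy.2
  have h2 : ContDiff ℝ ∞ fun y => line.symm (headTail k y).1 :=
    line.symm.contDiff.comp (contDiff_fst.comp (headTail k).contDiff)
  refine (h2.comp_contDiffOn (h1.comp (contDiff_sliceMap c).contDiffOn
    (s := ((A.leafChart a c).symm.trans (A.leafChart b d)).source) ?_)).mono ?_
  · intro y hy
    rw [OpenPartialHomeomorph.trans_source] at hy
    exact ⟨hy.1, hy.2.1⟩
  · intro y hy
    exact hy.1

theorem contMDiff_toBase : ContMDiff (𝓡 1) (𝓡 (k + 1)) ∞ A.toBase := by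
  intro p
  have h1 : ContMDiffOn (𝓡 1) (𝓡 1) ∞ (A.leafChart p (A.tail p p))
      (A.leafChart p (A.tail p p)).source := contMDiffOn_chart (x := p)
  have h2 : ContMDiffOn (𝓡 1) (𝓡 (k + 1)) ∞
      ((A.chart p).symm ∘ sliceMap (A.tail p p) ∘ A.leafChart p (A.tail p p))
      (A.leafChart p (A.tail p p)).source :=
    (contMDiffOn_symm_of_mem_maximalAtlas (A.mem_maximalAtlas p)).comp
      ((contDiff_sliceMap _).contMDiff.comp_contMDiffOn h1)
      fun y hy => (A.leafChart p (A.tail p p)).map_source hy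
  have h3 : ContMDiffOn (𝓡 1) (𝓡 (k + 1)) ∞ A.toBase (A.leafChart p (A.tail p p)).source :=
    h2.congr fun y hy => ((A.leafChart p (A.tail p p)).left_inv hy).symm
  exact h3.contMDiffAt ((A.leafChart p (A.tail p p)).open_source.mem_nhds
    (A.mem_leafChart_source p))

/-- A slice of a box is convex, and the inverse leaf chart carries it onto the plaque. -/
theorem isPreconnected_plaque (a : Q) (c : EuclideanSpace ℝ (Fin k)) :
    IsPreconnected (A.plaque a c) := by
  have h1 : Convex ℝ (A.leafChart a c).target := by
    obtain ⟨l, r, hbox⟩ := A.target_eq a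
    intro y hy z hz s t hs ht hst
    have h2 : sliceMap c (s • y + t • z) = s • sliceMap c y + t • sliceMap c z := by
      rw [sliceMap, sliceMap, sliceMap, ← map_smul, ← map_smul, ← map_add]
      congr 1
      refine Prod.ext (by simp) ?_
      change c = s • c + t • c
      rw [← add_smul, hst, one_smul]
    change sliceMap c (s • y + t • z) ∈ (A.chart a).target
    change sliceMap c y ∈ (A.chart a).target at hy
    change sliceMap c z ∈ (A.chart a).target at hz
    rw [hbox] at hy hz ⊢
    rw [h2]
    exact convex_openBox l r hy hz hs ht hst
  have h3 := h1.isPreconnected.image _ (A.leafChart a c).continuousOn_symm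
  rwa [(A.leafChart a c).symm_image_target_eq_source] at h3

/-- Distinct plaques of one chart are disjoint and open in the leaf topology, and a second countable
space contains only countably many disjoint nonempty open sets. -/
theorem countable_plaques_meeting (b : Q) {W : Set (LeafSpace A)} [SecondCountableTopology W] :
    {d | (W ∩ A.plaque b d).Nonempty}.Countable := by
  refine PairwiseDisjoint.countable_of_isOpen (α := W)
    (s := fun d => Subtype.val ⁻¹' A.plaque b d) ?_ ?_ ?_
  · intro d _ d' _ hne
    refine disjoint_left.2 fun p hp hp' => hne ?_
    exact hp.2.symm.trans hp'.2
  · exact fun d _ => (A.isOpen_plaque b d).preimage continuous_subtype_val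
  · rintro d ⟨p, hpW, hp⟩
    exact ⟨⟨p, hpW⟩, hp⟩

theorem secondCountableTopology_component [SecondCountableTopology Q] (p : LeafSpace A) :
    SecondCountableTopology (connectedComponent p) := by
  obtain ⟨S, hS, hcov⟩ := TopologicalSpace.countable_cover_nhds
    fun q => (A.chart q).open_source.mem_nhds (A.mem_source q)
  have : Countable S := hS.to_subtype
  have hsc : ∀ a c, SecondCountableTopology (A.plaque a c) := fun a c =>
    (A.leafChart a c).secondCountableTopology_source
  refine secondCountableTopology_connectedComponent
    (O := fun i : S × EuclideanSpace ℝ (Fin k) => A.plaque i.1 i.2)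
    (fun i => A.isOpen_plaque _ _) ?_ (fun i => hsc _ _) (fun i => ?_) p
  · refine eq_univ_of_forall fun q => ?_
    obtain ⟨a, ha, hqa⟩ := mem_iUnion₂.1 (hcov ▸ mem_univ (A.toBase q))
    exact mem_iUnion.2 ⟨(⟨a, ha⟩, A.tail a (A.toBase q)), hqa, rfl⟩
  · have := hsc i.1 i.2
    refine (countable_iUnion fun b : S => (A.countable_plaques_meeting b
      (W := A.plaque i.1 i.2)).image (Prod.mk b)).mono ?_
    rintro ⟨b, d⟩ hbd
    exact mem_iUnion.2 ⟨b, d, hbd, rfl⟩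

end FlatAtlas

end LeafSpace

/-! ### Leaves as immersed submanifolds; the foliation -/

section Leaves

variable {k : ℕ} {Q : Type u} [TopologicalSpace Q]
  [ChartedSpace (EuclideanSpace ℝ (Fin (k + 1))) Q]
  {D : ∀ q : Q, Submodule ℝ (TangentSpace (𝓡 (k + 1)) q)}

namespace FlatAtlas

variable (A : FlatAtlas D)

theorem isOpen_connectedComponents_fiber (i : ConnectedComponents (LeafSpace A)) :
    IsOpen (ConnectedComponents.mk ⁻¹' {i} : Set (LeafSpace A)) := by
  have : LocallyConnectedSpace (LeafSpace A) :=
    ChartedSpace.locallyConnectedSpace (EuclideanSpace ℝ (Fin 1)) _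
  obtain ⟨p, rfl⟩ := ConnectedComponents.surjective_coe i
  rw [connectedComponents_preimage_singleton]
  exact isOpen_connectedComponent

/-- The leaves: the connected components of the leaf space. -/
def leafOpens (i : ConnectedComponents (LeafSpace A)) : TopologicalSpace.Opens (LeafSpace A) :=
  ⟨ConnectedComponents.mk ⁻¹' {i}, A.isOpen_connectedComponents_fiber i⟩

theorem connectedSpace_leafOpens (i : ConnectedComponents (LeafSpace A)) :
    ConnectedSpace (A.leafOpens i) := by
  refine isConnected_iff_connectedSpace.1 ?_
  obtain ⟨p, rfl⟩ := ConnectedComponents.surjective_coe i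
  change IsConnected (ConnectedComponents.mk ⁻¹' {ConnectedComponents.mk p})
  rw [connectedComponents_preimage_singleton]
  exact isConnected_connectedComponent

theorem secondCountableTopology_leafOpens [SecondCountableTopology Q]
    (i : ConnectedComponents (LeafSpace A)) : SecondCountableTopology (A.leafOpens i) := by
  obtain ⟨p, rfl⟩ := ConnectedComponents.surjective_coe i
  change SecondCountableTopology
    (ConnectedComponents.mk ⁻¹' {ConnectedComponents.mk p} : Set (LeafSpace A))
  rw [connectedComponents_preimage_singleton]
  exact A.secondCountableTopology_component p

/-- The inclusion of a leaf. -/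
def leafIncl (i : ConnectedComponents (LeafSpace A)) (y : A.leafOpens i) : Q := A.toBase y.1

theorem contMDiff_leafIncl (i : ConnectedComponents (LeafSpace A)) :
    ContMDiff (𝓡 1) (𝓡 (k + 1)) ∞ (A.leafIncl i) :=
  A.contMDiff_toBase.comp contMDiff_subtype_val

/-- Read in the leaf chart and the flat chart, the inclusion is an affine parametrization of a
slice. Both injectivity of its differential and the identification of the tangent line follow from
this formula. -/
theorem headTail_mfderiv_leafIncl (i : ConnectedComponents (LeafSpace A)) (y : A.leafOpens i)
    (v : TangentSpace (𝓡 1) y) :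
    headTail k (mfderiv (𝓡 (k + 1)) (𝓡 (k + 1)) (A.chart (A.leafIncl i y)) (A.leafIncl i y)
        (mfderiv (𝓡 1) (𝓡 (k + 1)) (A.leafIncl i) y v)) =
      (line (mfderiv (𝓡 1) (𝓡 1) (chartAt (EuclideanSpace ℝ (Fin 1)) y) y v), 0) := by
  set p := A.leafIncl i y
  set e := chartAt (EuclideanSpace ℝ (Fin 1)) y
  set c := A.tail p p
  have hye : y ∈ e.source := mem_chart_source _ y
  have h1 : HasMFDerivAt (𝓡 1) (𝓡 (k + 1)) (A.chart p ∘ A.leafIncl i) y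
      ((mfderiv (𝓡 (k + 1)) (𝓡 (k + 1)) (A.chart p) p).comp
        (mfderiv (𝓡 1) (𝓡 (k + 1)) (A.leafIncl i) y)) :=
    HasMFDerivAt.comp y
      ((mdifferentiable_of_mem_maximalAtlas (A.mem_maximalAtlas p)).mdifferentiableAt
        (A.mem_source p)).hasMFDerivAt
      ((A.contMDiff_leafIncl i).mdifferentiable (by simp) y).hasMFDerivAt
  let T : EuclideanSpace ℝ (Fin 1) →L[ℝ] EuclideanSpace ℝ (Fin (k + 1)) :=
    (headTail k).symm.toContinuousLinearMap.comp (line.toContinuousLinearMap.prod 0)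
  have hT : HasFDerivAt (sliceMap c) T (e y) :=
    (headTail k).symm.toContinuousLinearMap.hasFDerivAt.comp _
      (line.toContinuousLinearMap.hasFDerivAt.prodMk (hasFDerivAt_const c _))
  have h2 : HasMFDerivAt (𝓡 1) (𝓡 (k + 1)) (sliceMap c ∘ e) y
      (T.comp (mfderiv (𝓡 1) (𝓡 1) e y)) :=
    HasMFDerivAt.comp y hT.hasMFDerivAt ((mdifferentiable_chart y).mdifferentiableAt hye).hasMFDerivAt
  have h3 : A.chart p ∘ A.leafIncl i =ᶠ[𝓝 y] sliceMap c ∘ e := by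
    have hopen : IsOpen ((fun z : A.leafOpens i => z.1) ⁻¹' A.plaque p c) :=
      (A.isOpen_plaque p c).preimage continuous_subtype_val
    filter_upwards [hopen.mem_nhds ⟨A.mem_source p, rfl⟩] with z hz
    change A.chart p (A.toBase z.1) = sliceMap c (line.symm (A.height p (A.toBase z.1)))
    rw [← A.sliceMap_line_symm_height, hz.2]
  have h4 := hasMFDerivAt_unique h1 (h2.congr_of_eventuallyEq h3)
  have h5 : mfderiv (𝓡 (k + 1)) (𝓡 (k + 1)) (A.chart p) p
      (mfderiv (𝓡 1) (𝓡 (k + 1)) (A.leafIncl i) y v) = T (mfderiv (𝓡 1) (𝓡 1) e y v) :=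
    DFunLike.congr_fun h4 v
  rw [h5]
  exact (headTail k).apply_symm_apply _

theorem injective_mfderiv_leafIncl (i : ConnectedComponents (LeafSpace A)) (y : A.leafOpens i) :
    Function.Injective (mfderiv (𝓡 1) (𝓡 (k + 1)) (A.leafIncl i) y) := by
  rw [injective_iff_map_eq_zero]
  intro v hv
  have h1 := congrArg Prod.fst (A.headTail_mfderiv_leafIncl i y v)
  rw [hv, map_zero] at h1
  have h2 : line (mfderiv (𝓡 1) (𝓡 1) (chartAt (EuclideanSpace ℝ (Fin 1)) y) y v) = 0 :=
    h1.symm.trans (congrArg Prod.fst (headTail k).map_zero)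
  have h3 : mfderiv (𝓡 1) (𝓡 1) (chartAt (EuclideanSpace ℝ (Fin 1)) y) y v = 0 :=
    (map_eq_zero_iff _ line.injective).1 h2
  exact (map_eq_zero_iff _ ((mdifferentiable_chart y).mfderiv_injective (mem_chart_source _ y))).1 h3

theorem range_mfderiv_leafIncl (i : ConnectedComponents (LeafSpace A)) (y : A.leafOpens i) :
    (mfderiv (𝓡 1) (𝓡 (k + 1)) (A.leafIncl i) y).range = D (A.leafIncl i y) := by
  set p := A.leafIncl i y
  ext w
  rw [A.mem_iff p p (A.mem_source p)]
  constructor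
  · rintro ⟨v, rfl⟩
    exact congrArg Prod.snd (A.headTail_mfderiv_leafIncl i y v)
  · intro hw
    obtain ⟨v, hv⟩ := (mdifferentiable_chart (I := 𝓡 1) y).mfderiv_surjective
      (mem_chart_source (EuclideanSpace ℝ (Fin 1)) y)
      (line.symm (headTail k (mfderiv (𝓡 (k + 1)) (𝓡 (k + 1)) (A.chart p) p w)).1)
    refine ⟨v, ?_⟩
    refine (mdifferentiable_of_mem_maximalAtlas (A.mem_maximalAtlas p)).mfderiv_injective
      (A.mem_source p) ((headTail k).injective ?_)
    refine (A.headTail_mfderiv_leafIncl i y v).trans (Prod.ext ?_ hw.symm)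
    rw [hv]
    exact line.apply_symm_apply _

/-- Points of the same plaque lie in the same leaf. -/
theorem mk_eq_of_tail_eq {a : Q} {p p' : LeafSpace A} (hp : A.toBase p ∈ (A.chart a).source)
    (hp' : A.toBase p' ∈ (A.chart a).source)
    (h : A.tail a (A.toBase p) = A.tail a (A.toBase p')) :
    ConnectedComponents.mk p = ConnectedComponents.mk p' :=
  ConnectedComponents.coe_eq_coe'.2
    ((A.isPreconnected_plaque a (A.tail a (A.toBase p'))).subset_connectedComponent
      ⟨hp', rfl⟩ ⟨hp, h⟩)

theorem transverse_eq_iff (y z : EuclideanSpace ℝ (Fin (k + 1))) :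
    transverse (k + 1) 1 y = transverse (k + 1) 1 z ↔ (headTail k y).2 = (headTail k z).2 := by
  constructor
  · intro h
    refine PiLp.ext fun j => ?_
    exact congrFun h ⟨j.succ, by simp⟩
  · intro h
    funext ⟨j, hj⟩
    obtain ⟨j, rfl⟩ := Fin.exists_succ_eq.2 (show j ≠ 0 by rintro rfl; simp at hj)
    exact congrFun (congrArg (fun c : EuclideanSpace ℝ (Fin k) => (c : Fin k → ℝ)) h) j

variable [T2Space Q] [SecondCountableTopology Q]

/-- The leaf as an immersed submanifold. -/
noncomputable def leaf (i : ConnectedComponents (LeafSpace A)) : ImmersedSubmanifold (k + 1) 1 Q :=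
  have := A.secondCountableTopology_leafOpens i
  { carrier := A.leafOpens i
    incl := A.leafIncl i
    smooth_incl := A.contMDiff_leafIncl i
    injective_incl := fun _ _ h => Subtype.ext h
    injective_mfderiv := A.injective_mfderiv_leafIncl i }

theorem mem_points_leaf_iff (i : ConnectedComponents (LeafSpace A)) (p : Q) :
    p ∈ (A.leaf i).points ↔ ConnectedComponents.mk (α := LeafSpace A) p = i := by
  constructor
  · rintro ⟨y, rfl⟩
    exact y.2
  · intro h
    exact ⟨⟨p, h⟩, rfl⟩

/-- A line field with a flat atlas is tangent to a foliation. -/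
noncomputable def foliation : Foliation (k + 1) 1 Q where
  index := ConnectedComponents (LeafSpace A)
  leaf := A.leaf
  connected := A.connectedSpace_leafOpens
  partition q := by
    simp only [mem_points_leaf_iff]
    exact existsUnique_eq'
  flat q := by
    refine ⟨A.chart q, A.mem_maximalAtlas q, A.mem_source q, A.target_eq q, fun i => ?_⟩
    -- The slices are those of the plaques meeting the leaf; there are countably many because the
    -- leaf is second countable. A plaque meeting the leaf lies in it entirely, being connected.
    refine ⟨(fun p => transverse (k + 1) 1 (A.chart q p)) ''
      {p | p ∈ (A.chart q).source ∧ ConnectedComponents.mk (α := LeafSpace A) p = i}, ?_, ?_⟩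
    · have : SecondCountableTopology (A.leafOpens i : Set (LeafSpace A)) :=
        A.secondCountableTopology_leafOpens i
      refine ((A.countable_plaques_meeting q (W := (A.leafOpens i : Set (LeafSpace A)))).image
        fun d => transverse (k + 1) 1 ((headTail k).symm (0, d))).mono ?_
      rintro _ ⟨p, ⟨hp, hpi⟩, rfl⟩
      refine ⟨A.tail q p, ⟨p, hpi, hp, rfl⟩, (transverse_eq_iff _ _).2 ?_⟩
      rw [(headTail k).apply_symm_apply]
      rfl
    · intro p hp
      rw [mem_points_leaf_iff]
      constructor
      · exact fun h => ⟨p, ⟨hp, h⟩, rfl⟩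
      · rintro ⟨p', ⟨hp', rfl⟩, h⟩
        exact A.mk_eq_of_tail_eq hp hp' ((transverse_eq_iff _ _).1 h).symm

end FlatAtlas

end Leaves

/-! ### Involutivity in flat charts -/

section Involutive

/-- Derivatives of maps with values in the kernel of a linear map have values in that kernel. -/
theorem apply_fderiv_eq_zero {E F G : Type*} [NormedAddCommGroup E] [NormedSpace ℝ E]
    [NormedAddCommGroup F] [NormedSpace ℝ F] [NormedAddCommGroup G] [NormedSpace ℝ G]
    {f : E → F} {π : F →L[ℝ] G} {y : E} (h : ∀ᶠ z in 𝓝 y, π (f z) = 0) (w : E) :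
    π (fderiv ℝ f y w) = 0 := by
  by_cases hf : DifferentiableAt ℝ f y
  · have h1 : HasFDerivAt (fun z => π (f z)) (π.comp (fderiv ℝ f y)) y :=
      π.hasFDerivAt.comp y hf.hasFDerivAt
    have h2 : HasFDerivAt (fun z => π (f z)) (0 : E →L[ℝ] G) y :=
      (hasFDerivAt_const (0 : G) y).congr_of_eventuallyEq h
    exact DFunLike.congr_fun (h1.unique h2) w
  · rw [fderiv_zero_of_not_differentiableAt hf]
    exact map_zero π

/-- In a vector space the bracket is `DZ(Y) - DY(Z)`, and derivatives of maps into `ker π` stay in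
`ker π`. -/
theorem apply_mlieBracket_eq_zero {E G : Type*} [NormedAddCommGroup E] [NormedSpace ℝ E]
    [NormedAddCommGroup G] [NormedSpace ℝ G] {Y Z : ∀ y : E, TangentSpace 𝓘(ℝ, E) y}
    {π : E →L[ℝ] G} {y : E} (hY : ∀ᶠ z in 𝓝 y, π (Y z) = 0) (hZ : ∀ᶠ z in 𝓝 y, π (Z z) = 0) :
    π (VectorField.mlieBracket 𝓘(ℝ, E) Y Z y) = 0 := by
  rw [← VectorField.mlieBracketWithin_univ, VectorField.mlieBracketWithin_eq_lieBracketWithin]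
  have h : ∀ Y Z : E → E, VectorField.lieBracketWithin ℝ Y Z univ y =
      fderiv ℝ Z y (Y y) - fderiv ℝ Y y (Z y) := fun Y Z => by
    rw [VectorField.lieBracketWithin_univ]
    rfl
  refine (congrArg π (h Y Z)).trans ((π.map_sub _ _).trans ?_)
  exact sub_eq_zero.2 ((apply_fderiv_eq_zero hZ _).trans (apply_fderiv_eq_zero hY _).symm)

variable {k : ℕ} {Q : Type u} [TopologicalSpace Q]
  [ChartedSpace (EuclideanSpace ℝ (Fin (k + 1))) Q] [IsManifold (𝓡 (k + 1)) ∞ Q]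
  {D : ∀ q : Q, Submodule ℝ (TangentSpace (𝓡 (k + 1)) q)}

/-- A line field with a flat atlas is involutive. -/
theorem FlatAtlas.isInvolutive (A : FlatAtlas D) : IsInvolutive D := by
  intro U V W hU hV hW hVD hWD q hq
  set φ := A.chart q
  have hqφ : q ∈ φ.source := A.mem_source q
  have hφ := mdifferentiable_of_mem_maximalAtlas (A.mem_maximalAtlas q)
  have hinv : ∀ y ∈ φ.target, ∀ v : TangentSpace (𝓡 (k + 1)) (φ.symm y),
      (mfderiv (𝓡 (k + 1)) (𝓡 (k + 1)) φ.symm y).inverse v =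
        mfderiv (𝓡 (k + 1)) (𝓡 (k + 1)) φ (φ.symm y) v := by
    intro y hy v
    have h := hφ.symm_comp_deriv (φ.map_target hy)
    rw [φ.right_inv hy] at h
    rw [ContinuousLinearMap.inverse_eq h (hφ.comp_symm_deriv hy)]
    rfl
  let π : EuclideanSpace ℝ (Fin (k + 1)) →L[ℝ] EuclideanSpace ℝ (Fin k) :=
    (ContinuousLinearMap.snd ℝ ℝ _).comp (headTail k).toContinuousLinearMap
  have hpull : ∀ Z : ∀ p : Q, TangentSpace (𝓡 (k + 1)) p, (∀ p ∈ U, Z p ∈ D p) →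
      ∀ᶠ y in 𝓝 (φ q),
        π (VectorField.mpullback (𝓡 (k + 1)) (𝓡 (k + 1)) φ.symm Z y) = 0 := by
    intro Z hZ
    have hN : IsOpen (φ.target ∩ φ.symm ⁻¹' U) := φ.isOpen_inter_preimage_symm hU
    have hqN : φ q ∈ φ.target ∩ φ.symm ⁻¹' U :=
      ⟨φ.map_source hqφ, by rwa [mem_preimage, φ.left_inv hqφ]⟩
    filter_upwards [hN.mem_nhds hqN] with y hy
    rw [VectorField.mpullback_apply, hinv y hy.1]
    exact (A.mem_iff q _ (φ.map_target hy.1) _).1 (hZ _ hy.2)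
  have hφq : φ.symm (φ q) = q := φ.left_inv hqφ
  have hmd : ∀ Z : ∀ p : Q, TangentSpace (𝓡 (k + 1)) p, SmoothVectorFieldOn Z U →
      MDifferentiableAt (𝓡 (k + 1)) (𝓡 (k + 1)).tangent
        (fun p => (⟨p, Z p⟩ : TangentBundle (𝓡 (k + 1)) Q)) (φ.symm (φ q)) := by
    intro Z hZ
    rw [hφq]
    exact (ContMDiffOn.contMDiffAt hZ (hU.mem_nhds hq)).mdifferentiableAt (by simp)
  have : IsManifold (𝓡 (k + 1)) (minSmoothness ℝ 3) Q := by
    rw [minSmoothness_of_isRCLikeNormedField]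
    exact IsManifold.of_le (n := ∞) ENat.LEInfty.out
  -- Naturality of the bracket moves the question to the chart, where membership in `D` means
  -- vanishing of the constant projection `π`.
  have hbr := VectorField.mpullback_mlieBracket (n := ∞) (hmd V hV) (hmd W hW)
    (contMDiffAt_symm_of_mem_maximalAtlas (A.mem_maximalAtlas q) (φ.map_source hqφ))
    (by rw [minSmoothness_of_isRCLikeNormedField]; exact ENat.LEInfty.out)
  rw [VectorField.mpullback_apply, hinv _ (φ.map_source hqφ)] at hbr
  have hzero := apply_mlieBracket_eq_zero (hpull V hVD) (hpull W hWD)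
  rw [← hbr] at hzero
  have h1 := (A.mem_iff q _ (φ.map_target (φ.map_source hqφ)) _).2 hzero
  rwa [hφq] at h1

end Involutive

/-! ### Orthogonal coordinates and the conclusion -/

section Main

variable {k : ℕ}
  {Q : Type u} [TopologicalSpace Q] [ChartedSpace (EuclideanSpace ℝ (Fin (k + 1))) Q]
  [IsManifold (𝓡 (k + 1)) ∞ Q]
  {M : Type v} [TopologicalSpace M] [ChartedSpace (EuclideanSpace ℝ (Fin 1)) M]
  [IsManifold (𝓡 1) ∞ M]

theorem nonempty_flatAtlas (g : Metric (k + 1) Q) {H : Q → M}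
    (hH : ContMDiff (𝓡 (k + 1)) (𝓡 1) ∞ H)
    (hsub : ∀ q, Function.Surjective (mfderiv (𝓡 (k + 1)) (𝓡 1) H q)) :
    Nonempty (FlatAtlas (gradientDistribution (m := 1) g H)) := by
  choose φ h1 h2 h3 h4 using exists_flat_chart g hH hsub
  exact ⟨⟨φ, h1, h2, h3, h4⟩⟩

/-- The kernel of `dξ` is `Δ_h`. Hence `dξ_j(∇h) = 0`, which by symmetry of the metric is `dh(∇ξ_j)
= 0`. A vector killed by `dH` and `dξ` is orthogonal to itself, and injectivity suffices because the
dimensions agree. -/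
theorem FlatAtlas.isOrthogonalCoordOn_tail {g : Metric (k + 1) Q} {H : Q → M}
    (A : FlatAtlas (gradientDistribution (m := 1) g H))
    (hH : ContMDiff (𝓡 (k + 1)) (𝓡 1) ∞ H)
    (hsub : ∀ q, Function.Surjective (mfderiv (𝓡 (k + 1)) (𝓡 1) H q)) (a : Q) :
    IsOrthogonalCoordOn (m := 1) g H (A.chart a).source (A.tail a) := by
  let π : EuclideanSpace ℝ (Fin (k + 1)) →L[ℝ] EuclideanSpace ℝ (Fin k) :=
    (ContinuousLinearMap.snd ℝ ℝ _).comp (headTail k).toContinuousLinearMap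
  have hd : ∀ p ∈ (A.chart a).source, HasMFDerivAt (𝓡 (k + 1)) (𝓡 k) (A.tail a) p
      (π.comp (mfderiv (𝓡 (k + 1)) (𝓡 (k + 1)) (A.chart a) p)) := by
    intro p hp
    have hπ : HasMFDerivAt (𝓡 (k + 1)) (𝓡 k) π (A.chart a p) π := π.hasMFDerivAt
    exact hπ.comp p ((mdifferentiable_of_mem_maximalAtlas
      (A.mem_maximalAtlas a)).mdifferentiableAt hp).hasMFDerivAt
  have hker : ∀ p ∈ (A.chart a).source, ∀ v : TangentSpace (𝓡 (k + 1)) p,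
      mfderiv (𝓡 (k + 1)) (𝓡 k) (A.tail a) p v = 0 ↔
        v ∈ gradientDistribution (m := 1) g H p := by
    intro p hp v
    rw [A.mem_iff a p hp, (hd p hp).mfderiv]
    rfl
  refine ⟨?_, fun p hp => ⟨fun j => ?_, ?_⟩⟩
  · exact π.contMDiff.comp_contMDiffOn (contMDiffOn_of_mem_maximalAtlas (A.mem_maximalAtlas a))
  · have hx := IsManifold.chart_mem_maximalAtlas (I := 𝓡 1) (n := ∞) (H p)
    have hxp := mem_chart_source (EuclideanSpace ℝ (Fin 1)) (H p)
    rw [← mfderiv_taskCoord_eq_zero_iff hH hx hxp, ← inner_gradient g, g.symm, inner_gradient]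
    set X := gradient g (taskCoord (m := 1) H (chartAt (EuclideanSpace ℝ (Fin 1)) (H p)) 0) p
    have hX : X ∈ gradientDistribution (m := 1) g H p := by
      rw [gradientDistribution_eq_orthogonalComplement g hH (hsub p),
        ← span_gradient_taskCoord g hH hx hxp (hsub p)]
      exact Submodule.mem_span_singleton_self _
    let ρ : EuclideanSpace ℝ (Fin k) →L[ℝ] ℝ := EuclideanSpace.proj j
    have h1 := (HasMFDerivAt.comp p (ρ.hasMFDerivAt (x := A.tail a p)) (hd p hp)).mfderiv
    have h2 : mfderiv (𝓡 (k + 1)) 𝓘(ℝ, ℝ) (fun q => A.tail a q j) p X =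
        ρ (headTail k (mfderiv (𝓡 (k + 1)) (𝓡 (k + 1)) (A.chart a) p X)).2 :=
      DFunLike.congr_fun h1 X
    refine h2.trans ?_
    rw [(A.mem_iff a p hp X).1 hX, map_zero]
    rfl
  · let F : TangentSpace (𝓡 (k + 1)) p →ₗ[ℝ]
        EuclideanSpace ℝ (Fin 1) × EuclideanSpace ℝ (Fin k) :=
      LinearMap.prod (mfderiv (𝓡 (k + 1)) (𝓡 1) H p).toLinearMap
        (mfderiv (𝓡 (k + 1)) (𝓡 k) (A.tail a) p).toLinearMap
    have hinj : Function.Injective F := by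
      rw [injective_iff_map_eq_zero]
      intro v hv
      have hv1 : mfderiv (𝓡 (k + 1)) (𝓡 1) H p v = 0 := congrArg Prod.fst hv
      have hv2 : mfderiv (𝓡 (k + 1)) (𝓡 k) (A.tail a) p v = 0 := congrArg Prod.snd hv
      rw [hker p hp, gradientDistribution_eq_orthogonalComplement g hH (hsub p)] at hv2
      by_contra hne
      exact (g.pos p v hne).ne' (hv2 v hv1)
    have : FiniteDimensional ℝ (TangentSpace (𝓡 (k + 1)) p) :=
      inferInstanceAs (FiniteDimensional ℝ (EuclideanSpace ℝ (Fin (k + 1))))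
    have hrank : Module.finrank ℝ (TangentSpace (𝓡 (k + 1)) p) =
        Module.finrank ℝ (EuclideanSpace ℝ (Fin 1) × EuclideanSpace ℝ (Fin k)) := by
      rw [Module.finrank_prod, finrank_euclideanSpace_fin, finrank_euclideanSpace_fin]
      exact finrank_euclideanSpace_fin.trans (add_comm k 1)
    exact ⟨hinj, (LinearMap.injective_iff_surjective_of_finrank_eq_finrank hrank).1 hinj⟩

theorem admitsOrthogonalFoliations [T2Space Q] [SecondCountableTopology Q]
    (g : Metric (k + 1) Q) {H : Q → M} (hH : ContMDiff (𝓡 (k + 1)) (𝓡 1) ∞ H)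
    (hsub : ∀ q, Function.Surjective (mfderiv (𝓡 (k + 1)) (𝓡 1) H q)) :
    AdmitsOrthogonalFoliations (m := 1) g H := by
  obtain ⟨A⟩ := nonempty_flatAtlas g hH hsub
  refine ⟨A.foliation, fun i y => ?_, fun q => ?_⟩
  · exact (A.range_mfderiv_leafIncl i y).trans
      (gradientDistribution_eq_orthogonalComplement g hH (hsub _))
  · refine ⟨(A.chart q).source, A.tail q, (A.chart q).open_source, A.mem_source q,
      A.isOrthogonalCoordOn_tail hH hsub q, fun i p hp p' hp' h hpi => ?_⟩
    have h1 := (A.mem_points_leaf_iff i p).1 hpi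
    exact (A.mem_points_leaf_iff i p').2 ((A.mk_eq_of_tail_eq hp hp' h).symm.trans h1)

end Main

/-- The empty manifold is foliated by no leaves. -/
def emptyFoliation (n k : ℕ) (Q : Type u) [TopologicalSpace Q]
    [ChartedSpace (EuclideanSpace ℝ (Fin n)) Q] [IsEmpty Q] : Foliation n k Q where
  index := PEmpty
  leaf := PEmpty.elim
  connected i := i.elim
  partition q := isEmptyElim q
  flat q := isEmptyElim q

end RedundantRobot

theorem mainTheorem2 {n : ℕ}
    {Q : Type u} [TopologicalSpace Q] [T2Space Q] [SecondCountableTopology Q]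
    [ChartedSpace (EuclideanSpace ℝ (Fin n)) Q] [IsManifold (𝓡 n) ∞ Q]
    {M : Type v} [TopologicalSpace M] [T2Space M] [SecondCountableTopology M]
    [ChartedSpace (EuclideanSpace ℝ (Fin 1)) M] [IsManifold (𝓡 1) ∞ M]
    (g : RedundantRobot.Metric n Q) (H : Q → M)
    (hH : ContMDiff (𝓡 n) (𝓡 1) ∞ H)
    (hsub : ∀ q, Function.Surjective (mfderiv (𝓡 n) (𝓡 1) H q)) :
    (∀ x ∈ IsManifold.maximalAtlas (𝓡 1) ∞ M, ∀ q : Q, H q ∈ x.source →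
      RedundantRobot.gradient g (RedundantRobot.taskCoord (m := 1) H x 0) q ≠ 0 ∧
      RedundantRobot.gradientDistribution (m := 1) g H q =
        Submodule.span ℝ {RedundantRobot.gradient g (RedundantRobot.taskCoord (m := 1) H x 0) q}) ∧
    RedundantRobot.IsInvolutive (RedundantRobot.gradientDistribution (m := 1) g H) ∧
    RedundantRobot.AdmitsOrthogonalFoliations (m := 1) g H := by
  refine ⟨fun x hx q hq => ⟨RedundantRobot.gradient_taskCoord_ne_zero g hH hx hq (hsub q),
    (RedundantRobot.gradientDistribution_eq_orthogonalComplement g hH (hsub q)).trans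
      (RedundantRobot.span_gradient_taskCoord g hH hx hq (hsub q)).symm⟩, ?_⟩
  rcases n with _ | k
  -- In dimension zero no differential is onto the tangent line of `M`, so `Q` has no points and
  -- every claim is vacuous. Otherwise `n = k + 1`, and a first coordinate can be split off.
  · have : IsEmpty Q := ⟨fun q => by
      have h1 : Subsingleton (TangentSpace (𝓡 0) q) :=
        inferInstanceAs (Subsingleton (EuclideanSpace ℝ (Fin 0)))
      have h2 : Nontrivial (TangentSpace (𝓡 1) (H q)) :=
        inferInstanceAs (Nontrivial (EuclideanSpace ℝ (Fin 1)))
      exact not_subsingleton _ (hsub q).subsingleton⟩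
    exact ⟨fun _ _ _ _ _ _ _ _ q => isEmptyElim q,
      RedundantRobot.emptyFoliation 0 1 Q, fun i => i.elim, fun q => isEmptyElim q⟩
  · obtain ⟨A⟩ := RedundantRobot.nonempty_flatAtlas g hH hsub
    exact ⟨A.isInvolutive, RedundantRobot.admitsOrthogonalFoliations g hH hsub⟩
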